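/- Let $2\le k\le n$; all indices are understood mod $n$. \textbf{Setting.} Let $\bar{\mathcal N}_{k,n}$ be the following perfect network on the torus. It is glued of $n$ pieces, the $i$-th of which contains a quadrilateral face with corners $UL_i$ (black), $UR_i$ (white), $LL_i$ (white), $LR_i$ (black), with a left edge $LL_i\to UL_i$, an upper edge $UL_i\to UR_i$, a right edge $UR_i\to LR_i$ and a lower edge $LL_i\to LR_i$, of weights $a_i,b_i,c_i,d_i$ respectively; besides there are black-black edges $LR_i\to UL_{i+1}$ and white-white edges $UR_i\to LL_{i+k-1}$. The counterclockwise order of the edges at a vertex is: at $LL_i$ the white-white edge, lower, left; at $UR_i$ upper, right, white-white; at $UL_i$ upper, black-black, left; at $LR_i$ black-black, right, lower. Let $\mathcal E$ be the space of weightings of the $6n$ edges by nonzero real numbers and let $\mathcal F_{\bar{\mathcal N}_{k,n}}$ be its quotient by the gauge group $(\mathbb R\setminus 0)^{4n}$, in which an element $g$ multiplies the weights of the edges leaving a vertex $v$ by $g_v$ and those of the edges entering $v$ by $g_v^{-1}$. A function on $\mathcal F_{\bar{\mathcal N}_{k,n}}$ is smooth if its pull-back to $\mathcal E$ is. The standard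 Poisson structure on $\mathcal F_{\bar{\mathcal N}_{k,n}}$ is induced by the following log-canonical bracket on $\mathcal E$: every edge weight is the product of the weights of its two half-edges; half-edge weights at different vertices commute; at a white vertex, if $h_0$ is the weight of the incoming half-edge and $h_1,h_2$ those of the next two in counterclockwise order, then $\{h_1,h_2\}=\frac12h_1h_2$ and $h_0$ commutes with $h_1,h_2$; at a black vertex, if $h_0$ is the weight of the outgoing half-edge and $h_1,h_2$ those of the next two in counterclockwise order, then $\{h_1,h_2\}=-\frac12h_1h_2$ and $h_0$ commutes with $h_1,h_2$. Let $\mathcal F^1_{\bar{\mathcal N}_{k,n}}\subset\mathcal F_{\bar{\mathcal N}_{k,n}}$ consist of the classes of the weightings such that all black-black and white-white edges have weight $1$ and $\prod_{i=1}^n b_ic_i=1$. For nonzero real $x_1,\dots,x_n,y_1,\dots,y_n$ let $\iota(\mathbf x,\mathbf y)$ be the class of the weighting with $a_i=x_i$, $d_i=y_i$ and all other weights equal to $1$. \textbf{Proposition.} (i) $\mathcal F^1_{\bar{\mathcal N}_{k,n}}$ is a Poisson submanifold (of codimension $1$) of $\mathcal F_{\bar{\mathcal N}_{k,n}}$ with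 respect to the standard Poisson structure. The numbers $x_i,y_i$ are global coordinates on it: $\iota$ is a bijection of $(\mathbb R\setminus 0)^{2n}$ onto $\mathcal F^1_{\bar{\mathcal N}_{k,n}}$, and the smooth functions of $(\mathbf x,\mathbf y)$ are exactly the functions $\varphi\circ\iota$ with $\varphi$ smooth on $\mathcal F_{\bar{\mathcal N}_{k,n}}$. For $n\ge 2k-1$ the restriction of the standard Poisson structure to $\mathcal F^1_{\bar{\mathcal N}_{k,n}}$ is given in these coordinates by $$\begin{aligned} \{x_i,x_{i+l}\}&=-x_ix_{i+l},\ 1\le l\le k-2; & \{y_i,y_{i+l}\}&=-y_iy_{i+l},\ 1\le l\le k-1;\\ \{y_i,x_{i+l}\}&=-y_ix_{i+l},\ 1\le l\le k-1; & \{y_i,x_{i-l}\}&=y_ix_{i-l},\ 0\le l\le k-2, \end{aligned}\tag{$*$}$$ where, up to skew-symmetry, only the non-zero brackets are listed. Let $n\ge 2k-1$ in (ii) and (iii), so that $(*)$ is meaningful. (ii) The bracket $(*)$ has rank $2(n-d)$ at every point with all $x_i,y_i$ nonzero, where $d=\gcd(k-1,n)$. The functions $$\prod_{i=0}^{n/d-1}x_{s+i(k-1)},\qquad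 \prod_{i=0}^{n/d-1}y_{s+i(k-1)},\qquad s=1,\dots,d,$$ are Casimir functions for $(*)$. (iii) The bracket $(*)$ is invariant under the rational map $T_k$ given by $$x_i^*=x_{i-r'-1}\frac{x_{i+r}+y_{i+r}}{x_{i-r'-1}+y_{i-r'-1}},\qquad y_i^*=y_{i-r'}\frac{x_{i+r+1}+y_{i+r+1}}{x_{i-r'}+y_{i-r'}},$$ with $r=\lfloor k/2\rfloor-1$ and $r'=k-2-r$, wherever all the sums $x_i+y_i$ are nonzero. -/

import Mathlib

open scoped ContDiff

noncomputable section

/-! ## Functions and log-canonical brackets on `(ℝ \ 0)^ι` -/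

/-- The space `(ℝ \ 0)^ι` with its coordinates indexed by `ι`. -/
abbrev RTorus (ι : Type*) := ι → ℝˣ

/-- A function on `(ℝ \ 0)^ι`, viewed as a function on `ℝ^ι` (extended by `0`). -/
def torusExt {ι : Type*} (f : RTorus ι → ℝ) : (ι → ℝ) → ℝ :=
  open Classical in
  fun v => if h : ∀ a, v a ≠ 0 then f (fun a => Units.mk0 (v a) (h a)) else 0

/-- Smooth functions on the open subset `(ℝ \ 0)^ι` of `ℝ^ι`. -/
def TorusSmooth {ι : Type*} [Fintype ι] (f : RTorus ι → ℝ) : Prop :=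
  ContDiffOn ℝ ∞ (torusExt f) {v | ∀ a, v a ≠ 0}

/-- The logarithmic partial derivative `w_a ∂f/∂w_a`. -/
def logPartial {ι : Type*} [Fintype ι] [DecidableEq ι] (f : RTorus ι → ℝ) (a : ι)
    (w : RTorus ι) : ℝ :=
  (w a : ℝ) * fderiv ℝ (torusExt f) (fun b => (w b : ℝ)) (Pi.single a 1)

lemma logPartial_mul {ι : Type*} [Fintype ι] [DecidableEq ι] (f : RTorus ι → ℝ)
    (w t : RTorus ι) (ht : ∀ u, f (u * t) = f u) (a : ι) :
    logPartial f a (w * t) = logPartial f a w := by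
  let L : (ι → ℝ) ≃L[ℝ] (ι → ℝ) :=
    ContinuousLinearEquiv.piCongrRight fun b => ContinuousLinearEquiv.unitsEquivAut ℝ (t b)
  have hL : ∀ v b, L v b = v b * (t b : ℝ) := fun v b => rfl
  have hcomp : torusExt f ∘ L = torusExt f := by
    funext v
    simp only [Function.comp, torusExt]
    by_cases h : ∀ b, v b ≠ 0
    · have h' : ∀ b, L v b ≠ 0 := fun b => by
        rw [hL]; exact mul_ne_zero (h b) (t b).ne_zero
      rw [dif_pos h, dif_pos h', ← ht (fun b => Units.mk0 (v b) (h b))]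
      congr 1
      funext b
      apply Units.ext
      simp [hL]
    · have h' : ¬ ∀ b, L v b ≠ 0 := fun h' => h fun b hb => h' b (by rw [hL, hb, zero_mul])
      rw [dif_neg h, dif_neg h']
  have hd := L.comp_right_fderiv (f := torusExt f) (x := fun b => (w b : ℝ))
  rw [hcomp] at hd
  have hw : (fun b => (((w * t) b : ℝˣ) : ℝ)) = L (fun b => (w b : ℝ)) := by
    funext b
    simp [hL]
  have hs : L (Pi.single a 1) = (t a : ℝ) • (Pi.single a (1 : ℝ) : ι → ℝ) := by
    funext b
    rw [hL]
    by_cases hb : b = a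
    · subst hb; simp
    · simp [hb]
  unfold logPartial
  rw [hd, hw, ContinuousLinearMap.comp_apply]
  change _ = _ * (fderiv ℝ (torusExt f) _) (L (Pi.single a 1))
  rw [hs, map_smul]
  simp only [Pi.mul_apply, Units.val_mul, smul_eq_mul]
  ring

/-- The bracket on functions on `(ℝ \ 0)^ι` determined by `{w_a, w_b} = C_{ab} w_a w_b`, that is,
`{f, g} = ∑ C_{ab} w_a w_b (∂f/∂w_a) (∂g/∂w_b)`. -/
def logCanonicalBracket {ι : Type*} [Fintype ι] [DecidableEq ι] (C : Matrix ι ι ℝ)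
    (f g : RTorus ι → ℝ) : RTorus ι → ℝ :=
  fun w => ∑ a, ∑ b, C a b * logPartial f a w * logPartial g b w

/-- The coordinate function `w_a`. -/
def torusCoord {ι : Type*} (a : ι) : RTorus ι → ℝ := fun w => (w a : ℝ)

/-- The rank of the log-canonical bracket at a point `w`: the rank of the matrix of the brackets of
the coordinate functions at `w`. -/
def bracketRankAt {ι : Type*} [Fintype ι] [DecidableEq ι] (C : Matrix ι ι ℝ)
    (w : RTorus ι) : ℕ :=
  (Matrix.of fun a b => logCanonicalBracket C (torusCoord a) (torusCoord b) w).rank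

/-- Casimir functions: smooth functions whose bracket with every smooth function vanishes. -/
def IsCasimir {ι : Type*} [Fintype ι] [DecidableEq ι] (C : Matrix ι ι ℝ)
    (f : RTorus ι → ℝ) : Prop :=
  TorusSmooth f ∧ ∀ g, TorusSmooth g → ∀ w, logCanonicalBracket C f g w = 0

/-- Invariance of a log-canonical bracket under a map `T` defined on `U`: `T` is Poisson on `U`. -/
def BracketInvariantOn {ι : Type*} [Fintype ι] [DecidableEq ι] (C : Matrix ι ι ℝ)
    (T : RTorus ι → RTorus ι) (U : Set (RTorus ι)) : Prop :=
  ∀ f g, TorusSmooth f → TorusSmooth g → ∀ w ∈ U,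
    logCanonicalBracket C (fun u => f (T u)) (fun u => g (T u)) w = logCanonicalBracket C f g (T w)

/-! ## Perfect networks on a closed oriented surface -/

/-- A perfect network on a closed oriented surface, as a directed ribbon graph. Every vertex is
trivalent; a white vertex has exactly one incoming edge, a black vertex has exactly one outgoing
edge. The edges at `v` are `halfEdge v 0, halfEdge v 1, halfEdge v 2` in counterclockwise order,
starting with the unique incoming (white `v`), respectively outgoing (black `v`), one. -/
structure PerfectNetwork (V E : Type*) where
  src : E → V
  tgt : E → V
  white : V → Bool
  halfEdge : V → Fin 3 → E
  white_in : ∀ v, white v = true → ∀ e, tgt e = v ↔ e = halfEdge v 0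
  white_out : ∀ v, white v = true → ∀ e, src e = v ↔ (e = halfEdge v 1 ∨ e = halfEdge v 2)
  black_out : ∀ v, white v = false → ∀ e, src e = v ↔ e = halfEdge v 0
  black_in : ∀ v, white v = false → ∀ e, tgt e = v ↔ (e = halfEdge v 1 ∨ e = halfEdge v 2)
  halfEdge_ne : ∀ v, halfEdge v 1 ≠ halfEdge v 2

/-- The standard log-canonical bracket of the weights of the three half-edges at a vertex: the
weights `h₁, h₂` of the two outgoing half-edges at a white vertex satisfy `{h₁, h₂} = h₁ h₂ / 2`,
those of the two incoming half-edges at a black vertex satisfy `{h₁, h₂} = - h₁ h₂ / 2`, and the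
remaining half-edge weight at the vertex commutes with both. -/
def vertexMatrix (isWhite : Bool) : Matrix (Fin 3) (Fin 3) ℝ :=
  (if isWhite then (1 / 2 : ℝ) else -(1 / 2 : ℝ)) • !![0, 0, 0; 0, 0, 1; 0, -1, 0]

namespace PerfectNetwork

variable {V E : Type*} (N : PerfectNetwork V E)

/-- The gauge group `(ℝ \ 0)^V`, acting on edge weights by multiplication: at every vertex `v` the
weights of the edges leaving `v` are multiplied by `g v`, those of the edges entering `v` by
`(g v)⁻¹`. -/
def gauge : (V → ℝˣ) →* RTorus E where
  toFun g := fun e => g (N.src e) * (g (N.tgt e))⁻¹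
  map_one' := by funext e; simp
  map_mul' g h := by
    funext e
    simp only [Pi.mul_apply, mul_inv]
    exact mul_mul_mul_comm _ _ _ _

/-- The space `𝓕_N`: the space `(ℝ \ 0)^E` of edge weights modulo the gauge group. -/
abbrev Space := RTorus E ⧸ N.gauge.range

/-- The class of an edge weighting in `𝓕_N`. -/
def cls (w : RTorus E) : N.Space := QuotientGroup.mk w

variable [Fintype E] [DecidableEq E]

/-- Smooth functions on `𝓕_N`: those whose pull-back to the space of edge weights is smooth. -/
def Smooth (φ : N.Space → ℝ) : Prop := TorusSmooth (fun w => φ (N.cls w))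

lemma logPartial_mul_gauge (φ : N.Space → ℝ) (w t : RTorus E) (ht : t ∈ N.gauge.range) (a : E) :
    logPartial (fun u => φ (N.cls u)) a (w * t) = logPartial (fun u => φ (N.cls u)) a w :=
  logPartial_mul _ w t (fun u => by
    have h : N.cls (u * t) = N.cls u := QuotientGroup.mk_mul_of_mem u ht
    simp only [h]) a

variable [Fintype V]

/-- The coefficients of the standard bracket `{w_e, w_{e'}} = C_{e e'} w_e w_{e'}` on the space of
edge weights: half-edge weights at different vertices commute, those at one vertex have the bracket
`vertexMatrix`, and the weight of an edge is the product of the weights of its two halves. -/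
def edgeMatrix : Matrix E E ℝ := fun e e' =>
  ∑ v, ∑ i, ∑ j,
    if e = N.halfEdge v i ∧ e' = N.halfEdge v j then vertexMatrix (N.white v) i j else 0

lemma bracket_aux (φ ψ : N.Space → ℝ) (w w' : RTorus E)
    (h : (QuotientGroup.leftRel N.gauge.range) w w') :
    logCanonicalBracket N.edgeMatrix (fun u => φ (N.cls u)) (fun u => ψ (N.cls u)) w =
      logCanonicalBracket N.edgeMatrix (fun u => φ (N.cls u)) (fun u => ψ (N.cls u)) w' := by
  rw [QuotientGroup.leftRel_apply] at h
  have e : w' = w * (w⁻¹ * w') := by simp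
  rw [e]
  simp only [logCanonicalBracket, N.logPartial_mul_gauge _ _ _ h]

/-- The standard Poisson bracket on `𝓕_N`, the push-forward of the standard bracket on the space of
edge weights. -/
def bracket (φ ψ : N.Space → ℝ) : N.Space → ℝ := fun s =>
  Quotient.liftOn' s
    (logCanonicalBracket N.edgeMatrix (fun u => φ (N.cls u)) (fun u => ψ (N.cls u)))
    (N.bracket_aux φ ψ)

/-- `S` is an embedded submanifold of `𝓕_N` of codimension `c`: locally it is the common zero set of
`c` smooth functions with linearly independent differentials. -/
def IsEmbeddedSubmanifold (S : Set N.Space) (c : ℕ) : Prop :=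
  ∀ s ∈ S, ∃ U : Set N.Space, IsOpen U ∧ s ∈ U ∧ ∃ h : Fin c → N.Space → ℝ,
    (∀ j, N.Smooth (h j)) ∧ S ∩ U = {t | ∀ j, h j t = 0} ∩ U ∧
    ∀ w, N.cls w = s →
      LinearIndependent ℝ (fun j => fun a : E => logPartial (fun u => h j (N.cls u)) a w)

/-- `S` is a Poisson submanifold of `𝓕_N` (of codimension `c`): it is an embedded submanifold and
the functions vanishing on `S` form a Poisson ideal (equivalently, all Hamiltonian vector fields are
tangent to `S`), so that the bracket restricts to `S`. -/
def IsPoissonSubmanifold (S : Set N.Space) (c : ℕ) : Prop :=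
  N.IsEmbeddedSubmanifold S c ∧
  ∀ φ ψ : N.Space → ℝ, N.Smooth φ → N.Smooth ψ → (∀ s ∈ S, ψ s = 0) →
    ∀ s ∈ S, N.bracket φ ψ s = 0

end PerfectNetwork

/-! ## The network `N̄_{k,n}` on the torus -/

/-- The four corners of a quadrilateral face. -/
inductive Corner
  | upperLeft | upperRight | lowerLeft | lowerRight
  deriving DecidableEq

instance : Fintype Corner :=
  ⟨{.upperLeft, .upperRight, .lowerLeft, .lowerRight}, fun c => by cases c <;> simp⟩

/-- The six edges of a piece: the left, upper, right and lower edges of the quadrilateral (of weights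
`a, b, c, d`), the white-white edge that leaves its upper right corner, and the black-black edge that
leaves its lower right corner. -/
inductive EdgeKind
  | left | upper | right | lower | whiteWhite | blackBlack
  deriving DecidableEq

instance : Fintype EdgeKind :=
  ⟨{.left, .upper, .right, .lower, .whiteWhite, .blackBlack}, fun c => by cases c <;> simp⟩

/-- The network `N̄_{k,n}` on the torus, glued of `n` pieces with cyclic labels `i : ZMod n`. In the
quadrilateral of the `i`-th piece the left edge goes up, the upper and lower edges go right and the
right edge goes down. The black-black edge leaves the lower right corner of the `i`-th quadrilateral
and enters the upper left corner of the `(i+1)`-st, the white-white edge leaves the upper right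
corner of the `i`-th quadrilateral and enters the lower left corner of the `(i+k-1)`-st. -/
def torusNetwork (k n : ℕ) : PerfectNetwork (Corner × ZMod n) (EdgeKind × ZMod n) where
  src
    | (.left, i) => (.lowerLeft, i)
    | (.upper, i) => (.upperLeft, i)
    | (.right, i) => (.upperRight, i)
    | (.lower, i) => (.lowerLeft, i)
    | (.whiteWhite, i) => (.upperRight, i)
    | (.blackBlack, i) => (.lowerRight, i)
  tgt
    | (.left, i) => (.upperLeft, i)
    | (.upper, i) => (.upperRight, i)
    | (.right, i) => (.lowerRight, i)
    | (.lower, i) => (.lowerRight, i)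
    | (.whiteWhite, i) => (.lowerLeft, i + (k - 1))
    | (.blackBlack, i) => (.upperLeft, i + 1)
  white
    | (.upperLeft, _) => false
    | (.upperRight, _) => true
    | (.lowerLeft, _) => true
    | (.lowerRight, _) => false
  halfEdge
    | (.upperLeft, i) => ![(.upper, i), (.blackBlack, i - 1), (.left, i)]
    | (.upperRight, i) => ![(.upper, i), (.right, i), (.whiteWhite, i)]
    | (.lowerLeft, i) => ![(.whiteWhite, i - (k - 1)), (.lower, i), (.left, i)]
    | (.lowerRight, i) => ![(.blackBlack, i), (.right, i), (.lower, i)]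
  white_in := by
    rintro ⟨c, i⟩ hc ⟨e, j⟩
    cases c <;> cases e <;> simp_all [eq_sub_iff_add_eq]
  white_out := by
    rintro ⟨c, i⟩ hc ⟨e, j⟩
    cases c <;> cases e <;> simp_all
  black_out := by
    rintro ⟨c, i⟩ hc ⟨e, j⟩
    cases c <;> cases e <;> simp_all
  black_in := by
    rintro ⟨c, i⟩ hc ⟨e, j⟩
    cases c <;> cases e <;> simp_all [eq_sub_iff_add_eq]
  halfEdge_ne := by
    rintro ⟨c, i⟩
    cases c <;> simp

/-- The locus `𝓕¹`: the classes of the edge weightings with all monochrome edges of weight `1` and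
`∏ b_i c_i = 1`. -/
def fOne (k n : ℕ) [NeZero n] : Set (torusNetwork k n).Space :=
  {s | ∃ w, (torusNetwork k n).cls w = s ∧ (∀ i, w (.whiteWhite, i) = 1) ∧
    (∀ i, w (.blackBlack, i) = 1) ∧ ∏ i, w (.upper, i) * w (.right, i) = 1}

/-- The `(x, y)`-space: `x_i` is the coordinate `Sum.inl i` and `y_i` is the coordinate `Sum.inr i`,
where `i : ZMod n`. -/
abbrev XYSpace (n : ℕ) := RTorus (ZMod n ⊕ ZMod n)

/-- The edge weighting with weight `x_i` on the left edge and `y_i` on the lower edge of the `i`-th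
quadrilateral, all other weights being `1`. -/
def xyWeights {n : ℕ} (p : XYSpace n) : RTorus (EdgeKind × ZMod n)
  | (.left, i) => p (.inl i)
  | (.lower, i) => p (.inr i)
  | _ => 1

/-- The class in `𝓕` of the network with weights `x_i, y_i`. -/
def xyPoint (k : ℕ) {n : ℕ} (p : XYSpace n) : (torusNetwork k n).Space :=
  (torusNetwork k n).cls (xyWeights p)

open Classical in
/-- The coefficients of the explicit bracket in the variables `x_i, y_i` (indices mod `n`):
`{x_i, x_{i+l}} = - x_i x_{i+l}` for `1 ≤ l ≤ k-2`, `{y_i, y_{i+l}} = - y_i y_{i+l}` for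
`1 ≤ l ≤ k-1`, `{y_i, x_{i+l}} = - y_i x_{i+l}` for `1 ≤ l ≤ k-1`, `{y_i, x_{i-l}} = y_i x_{i-l}` for
`0 ≤ l ≤ k-2`, together with the relations that follow from these by skew-symmetry; all other
brackets vanish. For `n ≥ 2k-1` the cases do not overlap. -/
def poissMatrix (k n : ℕ) : Matrix (ZMod n ⊕ ZMod n) (ZMod n ⊕ ZMod n) ℝ
  | .inl i, .inl j =>
      if ∃ l : ℕ, 1 ≤ l ∧ l ≤ k - 2 ∧ j = i + l then -1
      else if ∃ l : ℕ, 1 ≤ l ∧ l ≤ k - 2 ∧ i = j + l then 1 else 0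
  | .inr i, .inr j =>
      if ∃ l : ℕ, 1 ≤ l ∧ l ≤ k - 1 ∧ j = i + l then -1
      else if ∃ l : ℕ, 1 ≤ l ∧ l ≤ k - 1 ∧ i = j + l then 1 else 0
  | .inr i, .inl j =>
      if ∃ l : ℕ, 1 ≤ l ∧ l ≤ k - 1 ∧ j = i + l then -1
      else if ∃ l : ℕ, l ≤ k - 2 ∧ j = i - l then 1 else 0
  | .inl j, .inr i =>
      if ∃ l : ℕ, 1 ≤ l ∧ l ≤ k - 1 ∧ j = i + l then 1
      else if ∃ l : ℕ, l ≤ k - 2 ∧ j = i - l then -1 else 0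

/-- A nonzero real number as a unit of `ℝ` (and `1` for `0`). -/
def toUnit (a : ℝ) : ℝˣ := open Classical in if h : a ≠ 0 then Units.mk0 a h else 1

/-- The domain of the rational map `T_k` on the `(x, y)`-space: all `x_i + y_i` are nonzero. -/
def mapDomain (n : ℕ) : Set (XYSpace n) :=
  {p | ∀ i, (p (.inl i) : ℝ) + (p (.inr i) : ℝ) ≠ 0}

/-- The map `T_k`, where `r = ⌊k/2⌋ - 1`, `r' = k - 2 - r` and `σ_i = x_i + y_i`:
`x_i^* = x_{i-r'-1} σ_{i+r} / σ_{i-r'-1}` and `y_i^* = y_{i-r'} σ_{i+r+1} / σ_{i-r'}`.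
On `mapDomain` all these values are nonzero. -/
def mapT (k : ℕ) {n : ℕ} (p : XYSpace n) : XYSpace n :=
  let r : ℕ := k / 2 - 1
  let r' : ℕ := k - 2 - r
  let x : ZMod n → ℝ := fun i => p (.inl i)
  let y : ZMod n → ℝ := fun i => p (.inr i)
  let σ : ZMod n → ℝ := fun i => x i + y i
  fun
    | .inl i => toUnit (x (i - r' - 1) * (σ (i + r) / σ (i - r' - 1)))
    | .inr i => toUnit (y (i - r') * (σ (i + r + 1) / σ (i - r')))

end

/-! Write `k = m + 2`. A function on the quotient is gauge invariant, so at every vertex its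
logarithmic derivatives satisfy "incoming sum = outgoing sum" (`logPartial_halfEdge`). For
`N̄_{k,n}` these relations express all derivatives through those along the left edges (`α`) and the
lower edges (`β`), up to one additive constant: the black-black derivatives are obtained by discrete
integration around the cycle. In the sum of the vertex brackets this constant drops out
(`xyForm_eq_vertexSum`), and what remains is the skew form `xyForm` in `(α, β)`, a sum of cyclic
correlations.

This gives (i). The product of all upper, right and black-black weights is a gauge invariant,
`cycleWeight`, and `𝓕¹` is its level set at `1` (`cls_mem_fOne_iff`). A gauge built from path
weights brings each such class to the form `xyWeights` (`mul_gauge_gaugeFix`), and the resulting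
monomials `xyCoords` are gauge invariant everywhere, so they give a smooth retraction of the whole
quotient onto `𝓕¹`. At `xyWeights p` the quantities `α, β` are the derivatives along `𝓕¹`; hence a
function vanishing on `𝓕¹` has zero bracket there. The bound `n ≥ 2k - 1` matters only for
identifying `xyForm` with the listed coefficients: it keeps forward and backward index windows
disjoint.

For (ii), the kernel of the coefficient matrix consists of the pairs `(α, β)` that are both `(m +
1)`-periodic on `ℤ/n` (`poissMatrix_mulVec_eq_zero_iff`). It has dimension `2 gcd(k - 1, n)`, and
the gradients of the Casimir products lie in it.

For (iii), the pull-back by `T_k` acts on `(α, β)` by shifts plus a correction weighted by `x_j /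
σ_j` and `y_j / σ_j`. The weights add up to `1`, so they disappear from `α + β`; in the remaining
terms they multiply a symmetric expression, which skew-symmetry kills (`xyForm_pullback`). -/

noncomputable section

/-! ## Calculus on `(ℝ \ 0)^ι` -/

section TorusCalculus

variable {ι κ : Type*}

/-- The inclusion of `(ℝ \ 0)^ι` into `ℝ^ι`. -/
def torusVal (w : RTorus ι) : ι → ℝ := fun b => (w b : ℝ)

lemma torusVal_ne_zero (w : RTorus ι) (a : ι) : torusVal w a ≠ 0 := (w a).ne_zero

lemma torusExt_torusVal (f : RTorus ι → ℝ) (w : RTorus ι) : torusExt f (torusVal w) = f w := by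
  unfold torusExt
  rw [dif_pos (torusVal_ne_zero w)]
  congr 1
  funext a
  exact Units.ext rfl

lemma exists_torusVal_eq {v : ι → ℝ} (hv : ∀ a, v a ≠ 0) : ∃ w : RTorus ι, torusVal w = v :=
  ⟨fun a => Units.mk0 (v a) (hv a), rfl⟩

lemma torusExt_comp (f : RTorus κ → ℝ) (F : RTorus ι → RTorus κ) {v : ι → ℝ}
    (hv : ∀ a, v a ≠ 0) :
    torusExt (fun u => f (F u)) v = torusExt f fun j => torusExt (fun u => (F u j : ℝ)) v := by
  obtain ⟨w, rfl⟩ := exists_torusVal_eq hv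
  simp only [torusExt_torusVal]
  exact (torusExt_torusVal f (F w)).symm

variable [Fintype ι]

lemma isOpen_ne_zero : IsOpen {v : ι → ℝ | ∀ a, v a ≠ 0} := by
  simp only [Set.ofPred_forall]
  exact isOpen_iInter_of_finite fun a => isOpen_ne_fun (continuous_apply a) continuous_const

lemma eventually_ne_zero (w : RTorus ι) : ∀ᶠ v in nhds (torusVal w), ∀ a, v a ≠ 0 :=
  isOpen_ne_zero.mem_nhds (torusVal_ne_zero w)

/-- Differentiability at a point of `(ℝ \ 0)^ι`. -/
def TorusDiffAt (f : RTorus ι → ℝ) (w : RTorus ι) : Prop :=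
  DifferentiableAt ℝ (torusExt f) (torusVal w)

lemma TorusSmooth.diffAt {f : RTorus ι → ℝ} (hf : TorusSmooth f) (w : RTorus ι) :
    TorusDiffAt f w :=
  (hf.contDiffAt (eventually_ne_zero w)).differentiableAt (by simp)

lemma TorusSmooth.comp [Fintype κ] {f : RTorus κ → ℝ} (hf : TorusSmooth f) {F : RTorus ι → RTorus κ}
    (hF : ∀ j, TorusSmooth fun u => (F u j : ℝ)) : TorusSmooth fun u => f (F u) := by
  have h : ContDiffOn ℝ ∞ (fun v j => torusExt (fun u => (F u j : ℝ)) v) {v | ∀ a, v a ≠ 0} :=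
    contDiffOn_pi.2 hF
  refine (ContDiffOn.comp hf h fun v hv j => ?_).congr fun v hv => torusExt_comp f F hv
  obtain ⟨w, rfl⟩ := exists_torusVal_eq hv
  rw [torusExt_torusVal]
  exact (F w j).ne_zero

lemma torusSmooth_coord (a : ι) : TorusSmooth (torusCoord a) := by
  refine (contDiff_apply ℝ ℝ a).contDiffOn.congr fun v hv => ?_
  obtain ⟨w, rfl⟩ := exists_torusVal_eq hv
  exact torusExt_torusVal _ w

lemma torusSmooth_const (c : ℝ) : TorusSmooth fun _ : RTorus ι => c := by
  refine (contDiff_const (c := c)).contDiffOn.congr fun v hv => ?_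
  obtain ⟨w, rfl⟩ := exists_torusVal_eq hv
  exact torusExt_torusVal _ w

lemma TorusSmooth.sub {f g : RTorus ι → ℝ} (hf : TorusSmooth f) (hg : TorusSmooth g) :
    TorusSmooth fun u => f u - g u := by
  refine (ContDiffOn.sub hf hg).congr fun v hv => ?_
  obtain ⟨w, rfl⟩ := exists_torusVal_eq hv
  simp only [torusExt_torusVal]

lemma TorusSmooth.mul {f g : RTorus ι → ℝ} (hf : TorusSmooth f) (hg : TorusSmooth g) :
    TorusSmooth fun u => f u * g u := by
  refine (ContDiffOn.mul hf hg).congr fun v hv => ?_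
  obtain ⟨w, rfl⟩ := exists_torusVal_eq hv
  simp only [torusExt_torusVal]

lemma TorusSmooth.prod {α : Type*} (s : Finset α) {f : α → RTorus ι → ℝ}
    (hf : ∀ i ∈ s, TorusSmooth (f i)) : TorusSmooth fun u => ∏ i ∈ s, f i u := by
  classical
  induction s using Finset.induction_on with
  | empty => simpa using torusSmooth_const (1 : ℝ)
  | insert a s ha ih =>
    simp only [Finset.prod_insert ha]
    exact (hf a (by simp)).mul (ih fun i hi => hf i (by simp [hi]))

lemma TorusSmooth.units_inv {F : RTorus ι → ℝˣ} (hF : TorusSmooth fun u => (F u : ℝ)) :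
    TorusSmooth fun u => (((F u)⁻¹ : ℝˣ) : ℝ) := by
  refine (ContDiffOn.inv hF fun v hv => ?_).congr fun v hv => ?_
  · obtain ⟨w, rfl⟩ := exists_torusVal_eq hv
    rw [torusExt_torusVal]
    exact (F w).ne_zero
  · obtain ⟨w, rfl⟩ := exists_torusVal_eq hv
    simp only [torusExt_torusVal, Units.val_inv_eq_inv_val, Pi.inv_apply]

/-! ### Local properties and differentiation rules -/

/-- The set `s` leaves room for identities that hold only near `w`: the components of `mapT` agree
with their rational formulas only where the sums `x_i + y_i` do not vanish. -/
lemma torusExt_eventuallyEq {f g : RTorus ι → ℝ} {w : RTorus ι} {s : Set (ι → ℝ)}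
    (hs : s ∈ nhds (torusVal w)) (h : ∀ u, torusVal u ∈ s → f u = g u) :
    torusExt f =ᶠ[nhds (torusVal w)] torusExt g := by
  filter_upwards [hs, eventually_ne_zero w] with v hv hv0
  obtain ⟨u, rfl⟩ := exists_torusVal_eq hv0
  simp only [torusExt_torusVal, h u hv]

lemma TorusDiffAt.congr {f g : RTorus ι → ℝ} {w : RTorus ι} (hg : TorusDiffAt g w)
    {s : Set (ι → ℝ)} (hs : s ∈ nhds (torusVal w)) (h : ∀ u, torusVal u ∈ s → f u = g u) :
    TorusDiffAt f w :=
  DifferentiableAt.congr_of_eventuallyEq hg (torusExt_eventuallyEq hs h)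

lemma eventually_torusExt {p : (ι → ℝ) → ℝ → Prop} {f : RTorus ι → ℝ} {w : RTorus ι}
    (h : ∀ u, p (torusVal u) (f u)) :
    ∀ᶠ v in nhds (torusVal w), p v (torusExt f v) := by
  filter_upwards [eventually_ne_zero w] with v hv0
  obtain ⟨u, rfl⟩ := exists_torusVal_eq hv0
  rw [torusExt_torusVal]
  exact h u

lemma TorusDiffAt.add {f g : RTorus ι → ℝ} {w : RTorus ι} (hf : TorusDiffAt f w)
    (hg : TorusDiffAt g w) : TorusDiffAt (fun u => f u + g u) w := by
  refine (DifferentiableAt.add hf hg).congr_of_eventuallyEq ?_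
  filter_upwards [eventually_ne_zero w] with v hv
  obtain ⟨u, rfl⟩ := exists_torusVal_eq hv
  simp only [Pi.add_apply, torusExt_torusVal]

lemma TorusDiffAt.mul {f g : RTorus ι → ℝ} {w : RTorus ι} (hf : TorusDiffAt f w)
    (hg : TorusDiffAt g w) : TorusDiffAt (fun u => f u * g u) w := by
  refine (DifferentiableAt.mul hf hg).congr_of_eventuallyEq ?_
  filter_upwards [eventually_ne_zero w] with v hv
  obtain ⟨u, rfl⟩ := exists_torusVal_eq hv
  simp only [Pi.mul_apply, torusExt_torusVal]

lemma TorusDiffAt.inv {f : RTorus ι → ℝ} {w : RTorus ι} (hf : TorusDiffAt f w) (h : f w ≠ 0) :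
    TorusDiffAt (fun u => (f u)⁻¹) w := by
  refine (DifferentiableAt.inv hf (by rwa [torusExt_torusVal])).congr_of_eventuallyEq ?_
  filter_upwards [eventually_ne_zero w] with v hv
  obtain ⟨u, rfl⟩ := exists_torusVal_eq hv
  simp only [Pi.inv_apply, torusExt_torusVal]

variable [DecidableEq ι]

lemma logPartial_eq (f : RTorus ι → ℝ) (a : ι) (w : RTorus ι) :
    logPartial f a w = (w a : ℝ) * fderiv ℝ (torusExt f) (torusVal w) (Pi.single a 1) := rfl

lemma logPartial_congr {f g : RTorus ι → ℝ} {w : RTorus ι} {s : Set (ι → ℝ)}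
    (hs : s ∈ nhds (torusVal w)) (h : ∀ u, torusVal u ∈ s → f u = g u) (a : ι) :
    logPartial f a w = logPartial g a w := by
  rw [logPartial_eq, logPartial_eq, (torusExt_eventuallyEq hs h).fderiv_eq]

@[simp] lemma logPartial_const (c : ℝ) (a : ι) (w : RTorus ι) :
    logPartial (fun _ => c) a w = 0 := by
  have h : torusExt (fun _ : RTorus ι => c) =ᶠ[nhds (torusVal w)] fun _ => c :=
    eventually_torusExt (p := fun _ y => y = c) fun _ => rfl
  rw [logPartial_eq, h.fderiv_eq]
  simp

lemma logPartial_coord (b a : ι) (w : RTorus ι) :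
    logPartial (torusCoord b) a w = if a = b then (w b : ℝ) else 0 := by
  have h : torusExt (torusCoord b) =ᶠ[nhds (torusVal w)] fun v => v b :=
    eventually_torusExt (p := fun v y => y = v b) fun _ => rfl
  rw [logPartial_eq, h.fderiv_eq, (hasFDerivAt_apply b (torusVal w)).fderiv]
  by_cases hab : a = b
  · subst hab; simp
  · simp [hab, Ne.symm hab]

lemma logPartial_add {f g : RTorus ι → ℝ} {w : RTorus ι} (hf : TorusDiffAt f w)
    (hg : TorusDiffAt g w) (a : ι) :
    logPartial (fun u => f u + g u) a w = logPartial f a w + logPartial g a w := by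
  have h : torusExt (fun u => f u + g u) =ᶠ[nhds (torusVal w)] torusExt f + torusExt g := by
    filter_upwards [eventually_ne_zero w] with v hv
    obtain ⟨u, rfl⟩ := exists_torusVal_eq hv
    simp only [Pi.add_apply, torusExt_torusVal]
  simp only [logPartial_eq, h.fderiv_eq, fderiv_add hf hg, add_apply]
  ring

lemma logPartial_sub_const {f : RTorus ι → ℝ} {w : RTorus ι} (hf : TorusDiffAt f w) (c : ℝ)
    (a : ι) : logPartial (fun u => f u - c) a w = logPartial f a w := by
  have := logPartial_add hf ((torusSmooth_const (-c)).diffAt w) a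
  simpa [sub_eq_add_neg] using this

lemma logPartial_fun_mul {f g : RTorus ι → ℝ} {w : RTorus ι} (hf : TorusDiffAt f w)
    (hg : TorusDiffAt g w) (a : ι) :
    logPartial (fun u => f u * g u) a w = f w * logPartial g a w + g w * logPartial f a w := by
  have h : torusExt (fun u => f u * g u) =ᶠ[nhds (torusVal w)] torusExt f * torusExt g := by
    filter_upwards [eventually_ne_zero w] with v hv
    obtain ⟨u, rfl⟩ := exists_torusVal_eq hv
    simp only [Pi.mul_apply, torusExt_torusVal]
  simp only [logPartial_eq, h.fderiv_eq, fderiv_mul hf hg, add_apply,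
    smul_apply, torusExt_torusVal, smul_eq_mul]
  ring

/-- The chain rule for logarithmic partial derivatives. -/
lemma logPartial_comp [Fintype κ] [DecidableEq κ] {f : RTorus κ → ℝ} {F : RTorus ι → RTorus κ} {w : RTorus ι}
    (hf : TorusDiffAt f (F w)) (hF : ∀ j, TorusDiffAt (fun u => (F u j : ℝ)) w) (a : ι) :
    logPartial (fun u => f (F u)) a w =
      ∑ j, logPartial f j (F w) * (logPartial (fun u => (F u j : ℝ)) a w / (F w j : ℝ)) := by
  set G : (ι → ℝ) → κ → ℝ := fun v j => torusExt (fun u => (F u j : ℝ)) v with hG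
  have hGw : G (torusVal w) = torusVal (F w) := by
    funext j
    exact torusExt_torusVal _ w
  have h : torusExt (fun u => f (F u)) =ᶠ[nhds (torusVal w)] torusExt f ∘ G := by
    filter_upwards [eventually_ne_zero w] with v hv
    exact torusExt_comp f F hv
  have hGd : HasFDerivAt G
      (ContinuousLinearMap.pi fun j => fderiv ℝ (torusExt fun u => (F u j : ℝ)) (torusVal w))
      (torusVal w) :=
    hasFDerivAt_pi.2 fun j => (hF j).hasFDerivAt
  have hfd : HasFDerivAt (torusExt f) (fderiv ℝ (torusExt f) (torusVal (F w)))
      (G (torusVal w)) := by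
    rw [hGw]
    exact DifferentiableAt.hasFDerivAt hf
  rw [logPartial_eq, h.fderiv_eq, (hfd.comp _ hGd).fderiv, ContinuousLinearMap.comp_apply]
  have hx : ∀ x : κ → ℝ, fderiv ℝ (torusExt f) (torusVal (F w)) x =
      ∑ j, x j * fderiv ℝ (torusExt f) (torusVal (F w)) (Pi.single j 1) := fun x => by
    conv_lhs => rw [← Finset.univ_sum_single x, map_sum]
    refine Finset.sum_congr rfl fun j _ => ?_
    rw [show Pi.single j (x j) = x j • (Pi.single j (1 : ℝ) : κ → ℝ) by
      rw [← Pi.single_smul]; simp, map_smul, smul_eq_mul]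
  rw [hx, Finset.mul_sum]
  refine Finset.sum_congr rfl fun j _ => ?_
  have hj := (F w j).ne_zero
  simp only [logPartial_eq, ContinuousLinearMap.pi_apply]
  field_simp

/-! ### Logarithmic derivatives -/

/-- The logarithmic derivative `(w_a / f) ∂f/∂w_a`. -/
def dlog (f : RTorus ι → ℝ) (a : ι) (w : RTorus ι) : ℝ := logPartial f a w / f w

lemma dlog_coord (b a : ι) (w : RTorus ι) : dlog (torusCoord b) a w = if a = b then 1 else 0 := by
  unfold dlog
  rw [logPartial_coord]
  split_ifs <;> simp [torusCoord]

lemma dlog_const (c : ℝ) (a : ι) (w : RTorus ι) : dlog (fun _ => c) a w = 0 := by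
  simp [dlog]

lemma dlog_mul {f g : RTorus ι → ℝ} {w : RTorus ι} (hf : TorusDiffAt f w)
    (hg : TorusDiffAt g w) (hf0 : f w ≠ 0) (hg0 : g w ≠ 0) (a : ι) :
    dlog (fun u => f u * g u) a w = dlog f a w + dlog g a w := by
  unfold dlog
  rw [logPartial_fun_mul hf hg]
  field_simp
  ring

lemma dlog_congr {f g : RTorus ι → ℝ} {w : RTorus ι} {s : Set (ι → ℝ)}
    (hs : s ∈ nhds (torusVal w)) (h : ∀ u, torusVal u ∈ s → f u = g u) (a : ι) :
    dlog f a w = dlog g a w := by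
  unfold dlog
  rw [logPartial_congr hs h, h w (mem_of_mem_nhds hs)]

/-- Near `w` the product `f · f⁻¹` is the constant `1`, and `dlog` turns products into sums. -/
lemma dlog_inv {f : RTorus ι → ℝ} {w : RTorus ι} (hf : TorusDiffAt f w) (hf0 : f w ≠ 0) (a : ι) :
    dlog (fun u => (f u)⁻¹) a w = - dlog f a w := by
  have hs : {v | torusExt f v ≠ 0} ∈ nhds (torusVal w) :=
    (DifferentiableAt.continuousAt hf).eventually_ne (by rwa [torusExt_torusVal])
  have h := dlog_mul hf (hf.inv hf0) hf0 (inv_ne_zero hf0) a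
  rw [dlog_congr (g := fun _ => 1) hs fun u hu => mul_inv_cancel₀ (by
    rwa [Set.mem_ofPred_eq, torusExt_torusVal] at hu), dlog_const] at h
  linarith

lemma dlog_prod {α : Type*} (s : Finset α) {f : α → RTorus ι → ℝ} {w : RTorus ι}
    (hf : ∀ i ∈ s, TorusSmooth (f i)) (h0 : ∀ i ∈ s, f i w ≠ 0) (a : ι) :
    dlog (fun u => ∏ i ∈ s, f i u) a w = ∑ i ∈ s, dlog (f i) a w := by
  classical
  induction s using Finset.induction_on with
  | empty => simpa using dlog_const 1 a w
  | insert b s hb ih =>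
    simp only [Finset.prod_insert hb, Finset.sum_insert hb]
    have hs : ∀ i ∈ s, TorusSmooth (f i) := fun i hi => hf i (by simp [hi])
    have h0s : ∀ i ∈ s, f i w ≠ 0 := fun i hi => h0 i (by simp [hi])
    rw [dlog_mul ((hf b (by simp)).diffAt w) ((TorusSmooth.prod s hs).diffAt w) (h0 b (by simp))
      (Finset.prod_ne_zero_iff.2 h0s), ih hs h0s]

end TorusCalculus

/-! ## Correlations of functions on `ℤ/n` -/

section Correlation

variable {n : ℕ} [NeZero n]

/-- The correlation `∑ f_i g_{i+c}`. -/
def corr (f g : ZMod n → ℝ) (c : ZMod n) : ℝ := ∑ i, f i * g (i + c)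

lemma sum_shift (f : ZMod n → ℝ) (a : ZMod n) : ∑ i, f (i + a) = ∑ i, f i :=
  Equiv.sum_comp (Equiv.addRight a) f

lemma corr_comm (f g : ZMod n → ℝ) (c : ZMod n) : corr f g c = corr g f (-c) := by
  unfold corr
  rw [← sum_shift (fun i => g i * f (i + -c)) c]
  refine Finset.sum_congr rfl fun i _ => ?_
  rw [add_neg_cancel_right, mul_comm]

lemma corr_shift_left (f g : ZMod n → ℝ) (a c : ZMod n) :
    corr (fun i => f (i + a)) g c = corr f g (c - a) := by
  unfold corr
  rw [← sum_shift (fun i => f i * g (i + (c - a))) a]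
  refine Finset.sum_congr rfl fun i _ => ?_
  rw [show i + a + (c - a) = i + c by ring]

lemma corr_shift_right (f g : ZMod n → ℝ) (a c : ZMod n) :
    corr f (fun i => g (i + a)) c = corr f g (c + a) := by
  simp only [corr, add_assoc]

lemma corr_add_left (f f' g : ZMod n → ℝ) (c : ZMod n) :
    corr (fun i => f i + f' i) g c = corr f g c + corr f' g c := by
  simp [corr, add_mul, Finset.sum_add_distrib]

lemma corr_add_right (f g g' : ZMod n → ℝ) (c : ZMod n) :
    corr f (fun i => g i + g' i) c = corr f g c + corr f g' c := by
  simp [corr, mul_add, Finset.sum_add_distrib]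

lemma corr_sub_left (f f' g : ZMod n → ℝ) (c : ZMod n) :
    corr (fun i => f i - f' i) g c = corr f g c - corr f' g c := by
  simp [corr, sub_mul, Finset.sum_sub_distrib]

lemma corr_const_left (x : ℝ) (g : ZMod n → ℝ) (c : ZMod n) :
    corr (fun _ => x) g c = x * ∑ i, g i := by
  rw [← sum_shift g c, Finset.mul_sum]
  rfl

lemma corr_sum_left {α : Type*} (s : Finset α) (f : α → ZMod n → ℝ) (g : ZMod n → ℝ)
    (c : ZMod n) : corr (fun i => ∑ l ∈ s, f l i) g c = ∑ l ∈ s, corr (f l) g c := by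
  simp only [corr, Finset.sum_mul]
  exact Finset.sum_comm

/-- Half of the bilinear form of the bracket in the `(x, y)`-coordinates; `α, β` stand for the
logarithmic derivatives with respect to `x, y`. -/
def halfForm (m : ℕ) (α β α' β' : ZMod n → ℝ) : ℝ :=
  -(∑ l ∈ Finset.range m, corr (fun i => α i + β i) (fun i => α' i + β' i) ((l : ZMod n) + 1)
    + corr β (fun i => α' i + β' i) ((m : ZMod n) + 1) - corr β (fun i => α' i + β' i) 0)

/-- The bilinear form of the bracket in the `(x, y)`-coordinates. -/
def xyForm (m : ℕ) (α β α' β' : ZMod n → ℝ) : ℝ :=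
  halfForm m α β α' β' - halfForm m α' β' α β

lemma xyForm_swap (m : ℕ) (α β α' β' : ZMod n → ℝ) :
    xyForm m α β α' β' = - xyForm m α' β' α β := by
  simp [xyForm]

/-- The form is preserved by the transposed logarithmic Jacobian of `T_k`; `A, B` are the images of
`α, β`. -/
lemma xyForm_pullback (m r r' : ℕ) (hr : r + r' = m) (η α β α' β' A B A' B' : ZMod n → ℝ)
    (hB : ∀ j, B j = β (j + r') + η j *
      ((α (j - r) + β (j - r - 1)) - (α (j + r' + 1) + β (j + r'))))
    (hB' : ∀ j, B' j = β' (j + r') + η j *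
      ((α' (j - r) + β' (j - r - 1)) - (α' (j + r' + 1) + β' (j + r'))))
    (hS : ∀ j, A j + B j = α (j - r) + β (j - r - 1))
    (hS' : ∀ j, A' j + B' j = α' (j - r) + β' (j - r - 1)) :
    xyForm m A B A' B' = xyForm m α β α' β' := by
  -- Shifting `β` and `β'` together changes the lag only in the mixed products, by one step up or
  -- down. Summed over `l` these changes telescope to boundary terms.
  have key : ∀ α β α' β' : ZMod n → ℝ,
      ∑ l ∈ Finset.range m, corr (fun i => α i + β (i + -1)) (fun i => α' i + β' (i + -1))
        ((l : ZMod n) + 1) =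
      ∑ l ∈ Finset.range m, corr (fun i => α i + β i) (fun i => α' i + β' i) ((l : ZMod n) + 1)
      - (corr (fun i => α i + β i) β' m - corr (fun i => α i + β i) β' 0)
      - (corr β (fun i => α' i + β' (i + -1)) 1
        - corr β (fun i => α' i + β' (i + -1)) ((m : ZMod n) + 1)) := by
    intro α β α' β'
    have h1 := Finset.sum_range_sub (fun l : ℕ => corr (fun i => α i + β i) β' (l : ZMod n)) m
    have h2 := Finset.sum_range_sub'
      (fun l : ℕ => corr β (fun i => α' i + β' (i + -1)) ((l : ZMod n) + 1)) m
    simp only [Nat.cast_zero, Nat.cast_add, Nat.cast_one, zero_add] at h1 h2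
    rw [← h1, ← h2, ← Finset.sum_sub_distrib, ← Finset.sum_sub_distrib]
    refine Finset.sum_congr rfl fun l _ => ?_
    simp only [corr_add_left, corr_add_right, corr_shift_left, corr_shift_right]
    rw [show (l : ZMod n) + 1 - -1 = l + 1 + 1 by ring]
    simp only [add_neg_cancel_right]
    ring_nf
  have hA : ∀ (A B α β : ZMod n → ℝ), (∀ j, A j + B j = α (j - r) + β (j - r - 1)) →
      (fun i => A i + B i) = fun i => (fun j => α j + β (j + -1)) (i + -(r : ZMod n)) := by
    intro A B α β h
    funext i
    simp only [h, sub_eq_add_neg]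
  have hc : ∀ (f g : ZMod n → ℝ) (c : ZMod n),
      corr (fun i => f (i + -(r : ZMod n))) (fun i => g (i + -(r : ZMod n))) c = corr f g c := by
    intro f g c
    rw [corr_shift_left f (fun i => g (i + -(r : ZMod n))), corr_shift_right]
    congr 1
    ring
  have hm : (m : ZMod n) = r + r' := by rw [← hr]; push_cast; rfl
  -- The difference of `A' + B'` at `j + m + 1` and at `j` is minus the bracket multiplying `η j` in
  -- `hB'`. The `η`-terms are therefore symmetric in the primed and unprimed data and cancel.
  have hBD : corr B (fun i => A' i + B' i) ((m : ZMod n) + 1) - corr B (fun i => A' i + B' i) 0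
      - (corr B' (fun i => A i + B i) ((m : ZMod n) + 1) - corr B' (fun i => A i + B i) 0) =
      corr β (fun i => α' i + β' (i + -1)) 1 - corr β (fun i => α' i + β' (i + -1)) (-m)
      - (corr β' (fun i => α i + β (i + -1)) 1 - corr β' (fun i => α i + β (i + -1)) (-m)) := by
    have e : ∀ (β α' β' : ZMod n → ℝ),
        corr β (fun i => α' i + β' (i + -1)) 1 - corr β (fun i => α' i + β' (i + -1)) (-m) =
        ∑ j, β (j + r') * ((α' (j + r' + 1) + β' (j + r')) - (α' (j - r) + β' (j - r - 1))) := by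
      intro β α' β'
      rw [corr, corr, ← Finset.sum_sub_distrib, ← sum_shift _ (r' : ZMod n)]
      refine Finset.sum_congr rfl fun j _ => ?_
      rw [hm, show j + (r' : ZMod n) + 1 + -1 = j + r' by ring,
        show j + (r' : ZMod n) + -(r + r') = j - r by ring, ← sub_eq_add_neg (j - (r : ZMod n))]
      ring
    rw [e, e]
    simp only [corr, hS, hS', ← Finset.sum_sub_distrib]
    refine Finset.sum_congr rfl fun j _ => ?_
    rw [hB, hB', hm, show j + ((r : ZMod n) + r' + 1) - r = j + r' + 1 by ring,
      show j + (r' : ZMod n) + 1 - 1 = j + r' by ring, add_zero]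
    ring
  have hSS : ∀ (A B α β A' B' α' β' : ZMod n → ℝ),
      (∀ j, A j + B j = α (j - r) + β (j - r - 1)) →
      (∀ j, A' j + B' j = α' (j - r) + β' (j - r - 1)) → ∀ c,
      corr (fun i => A i + B i) (fun i => A' i + B' i) c =
        corr (fun i => α i + β (i + -1)) (fun i => α' i + β' (i + -1)) c := by
    intro A B α β A' B' α' β' h h' c
    rw [hA A B α β h, hA A' B' α' β' h',
      hc (fun j => α j + β (j + -1)) (fun j => α' j + β' (j + -1))]
  have hcomm : ∀ (f g : ZMod n → ℝ) (c : ZMod n), corr f g (-c) = corr g f c := by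
    intro f g c
    rw [corr_comm, neg_neg]
  have h1 := key α β α' β'
  have h2 := key α' β' α β
  simp only [← hSS A B α β A' B' α' β' hS hS'] at h1
  simp only [← hSS A' B' α' β' A B α β hS' hS] at h2
  unfold xyForm halfForm
  rw [h1, h2]
  simp only [corr_add_right, corr_add_left α, corr_add_left α',
    corr_shift_right] at hBD ⊢
  rw [add_neg_cancel, ← neg_add, hcomm, hcomm, hcomm, hcomm] at hBD
  rw [add_neg_cancel_right, add_neg_cancel]
  have h0 : ∀ (f g : ZMod n → ℝ), corr f g 0 = corr g f 0 := by
    intro f g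
    rw [corr_comm, neg_zero]
  rw [h0 β' β] at hBD
  rw [h0 α' β, h0 β' β, h0 β' α]
  linarith

/-- The form computed from the brackets at the vertices of the network. -/
lemma xyForm_eq_vertexSum (m : ℕ) (α β u v t α' β' u' v' t' : ZMod n → ℝ)
    (hv : ∀ i, v (i - (m + 1)) = α i + β i) (hv' : ∀ i, v' (i - (m + 1)) = α' i + β' i)
    (ht : ∀ i, u i = t i + β i) (ht' : ∀ i, u' i = t' i + β' i)
    (hu : ∀ i, u (i - 1) + α i = t i + v i) (hu' : ∀ i, u' (i - 1) + α' i = t' i + v' i) :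
    ∑ i, (-(1 / 2) * (u (i - 1) * α' i - α i * u' (i - 1))
      + 1 / 2 * (t i * v' i - v i * t' i) + 1 / 2 * (β i * α' i - α i * β' i)
      - 1 / 2 * (t i * β' i - β i * t' i)) = xyForm m α β α' β' := by
  have hconst : ∀ f : ZMod n → ℝ, (∀ i, f (i + 1) = f i) → ∀ i, f i = f 0 := by
    intro f hf i
    rw [← ZMod.natCast_zmod_val i]
    induction i.val with
    | zero => simp
    | succ j ih => rw [Nat.cast_succ, hf, ih]
  have hv2 : ∀ (v α β : ZMod n → ℝ), (∀ i, v (i - (m + 1)) = α i + β i) →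
      v = fun i => (fun j => α j + β j) (i + (m + 1)) := by
    intro v α β h
    funext i
    simp only [← h, add_sub_cancel_right]
  -- Put `s = α + β`. Eliminating `t` and `v` gives `u i - u (i - 1) = s i - s (i + m + 1)`, so `u`
  -- plus the sum of the next `m + 1` values of `s` is constant.
  have hu2 : ∀ (α β u v t : ZMod n → ℝ), (∀ i, v (i - (m + 1)) = α i + β i) →
      (∀ i, u i = t i + β i) → (∀ i, u (i - 1) + α i = t i + v i) → ∃ c : ℝ,
      u = fun i => c - ∑ l ∈ Finset.range (m + 1),
        (fun j => α j + β j) (i + ((l : ZMod n) + 1)) := by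
    intro α β u v t hv ht hu
    refine ⟨u 0 + ∑ l ∈ Finset.range (m + 1), (α (0 + (l + 1)) + β (0 + (l + 1))), ?_⟩
    have := hconst (fun i => u i + ∑ l ∈ Finset.range (m + 1),
      (α (i + (l + 1)) + β (i + (l + 1)))) ?_
    · funext i
      have := this i
      simp only at this ⊢
      linarith
    · intro i
      have h1 := hu (i + 1)
      have h2 := ht (i + 1)
      have h3 := congrFun (hv2 v α β hv) (i + 1)
      rw [add_sub_cancel_right] at h1
      simp only at h3 ⊢
      rw [Finset.sum_range_succ, Finset.sum_range_succ' (n := m)]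
      have h4 : ∀ l : ℕ, i + (((l + 1 : ℕ) : ZMod n) + 1) = i + 1 + (l + 1) := by
        intro l; push_cast; ring
      simp only [h4, Nat.cast_zero, zero_add]
      linarith
  obtain ⟨c, hc⟩ := hu2 α β u v t hv ht hu
  obtain ⟨c', hc'⟩ := hu2 α' β' u' v' t' hv' ht' hu'
  -- The constant `c` is absent on the right because its coefficient is `-∑ α' + ∑ (α' + β') - ∑ β'
  -- = 0`. Turning negative lags into positive ones by `hcomm` identifies the right-hand side with
  -- `xyForm` itself.
  have hP : ∀ (c : ℝ) (α β u t α' β' v' : ZMod n → ℝ) (ht : ∀ i, u i = t i + β i)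
      (hv' : v' = fun i => (fun j => α' j + β' j) (i + (m + 1)))
      (hc : u = fun i => c - ∑ l ∈ Finset.range (m + 1),
        (fun j => α j + β j) (i + ((l : ZMod n) + 1))),
      ∑ i, (-(u (i - 1) * α' i) + t i * v' i + β i * α' i - t i * β' i) =
      ∑ l ∈ Finset.range m, corr (fun i => α i + β i) α' (-((l : ZMod n) + 1))
      + corr (fun i => α i + β i) α' 0
      + (∑ l ∈ Finset.range m, corr (fun i => α i + β i) β' (-((l : ZMod n) + 1))
        + corr (fun i => α i + β i) β' (-((m : ZMod n) + 1)))
      - (∑ l ∈ Finset.range m, corr (fun i => α i + β i) (fun i => α' i + β' i) ((l : ZMod n) + 1)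
        + corr (fun i => α i + β i) (fun i => α' i + β' i) 0)
      - corr β (fun i => α' i + β' i) ((m : ZMod n) + 1)
      + corr β (fun i => α' i + β' i) 0 := by
    intro c α β u t α' β' v' ht hv' hc
    have e1 : ∑ i, (-(u (i - 1) * α' i) + t i * v' i + β i * α' i - t i * β' i) =
      - corr u α' 1 + corr u (fun i => α' i + β' i) ((m : ZMod n) + 1)
      - corr β (fun i => α' i + β' i) ((m : ZMod n) + 1)
      - corr u β' 0 + corr β (fun i => α' i + β' i) 0 := by
      have : corr u α' 1 = ∑ i, u (i - 1) * α' i := by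
        rw [corr, ← sum_shift (fun i => u (i - 1) * α' i) 1]
        simp
      rw [this]
      simp only [corr, ← Finset.sum_sub_distrib, ← Finset.sum_add_distrib,
        ← Finset.sum_neg_distrib, add_zero]
      refine Finset.sum_congr rfl fun i _ => ?_
      rw [hv', show t i = u i - β i by rw [ht]; ring]
      ring
    have e2 : ∀ (g : ZMod n → ℝ) (a : ZMod n), corr u g a = c * ∑ i, g i -
        ∑ l ∈ Finset.range (m + 1), corr (fun i => α i + β i) g (a - ((l : ZMod n) + 1)) := by
      intro g a
      rw [hc, corr_sub_left, corr_const_left, corr_sum_left]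
      congr 1
      refine Finset.sum_congr rfl fun l _ => ?_
      rw [corr_shift_left (fun j => α j + β j)]
    have e3 : ∑ l ∈ Finset.range (m + 1), corr (fun i => α i + β i) (fun i => α' i + β' i)
        ((m : ZMod n) + 1 - ((l : ZMod n) + 1)) =
        ∑ l ∈ Finset.range (m + 1), corr (fun i => α i + β i) (fun i => α' i + β' i) l := by
      rw [← Finset.sum_range_reflect]
      refine Finset.sum_congr rfl fun l hl => ?_
      rw [Finset.mem_range] at hl
      rw [show m + 1 - 1 - l = m - l by omega, Nat.cast_sub (by omega)]
      congr 1
      ring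
    rw [e1, e2, e2, e2, e3, Finset.sum_add_distrib, Finset.sum_range_succ' (n := m),
      Finset.sum_range_succ' (n := m), Finset.sum_range_succ (n := m)]
    have h4 : ∀ l : ℕ, (1 : ZMod n) - ((l : ZMod n) + 1 + 1) = -((l : ZMod n) + 1) := by
      intro l; ring
    simp only [h4, zero_sub, Nat.cast_zero, zero_add, sub_self, Nat.cast_add, Nat.cast_one]
    ring
  have h1 := hP c α β u t α' β' v' ht (hv2 _ _ _ hv') hc
  have h2 := hP c' α' β' u' t' α β v ht' (hv2 _ _ _ hv) hc'
  -- The two sums are opposite to each other, being `xyForm` and its swap, so the factor `1 / 2`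
  -- restores a single copy.
  have h3 : ∑ i, (-(1 / 2) * (u (i - 1) * α' i - α i * u' (i - 1))
      + 1 / 2 * (t i * v' i - v i * t' i) + 1 / 2 * (β i * α' i - α i * β' i)
      - 1 / 2 * (t i * β' i - β i * t' i)) =
      1 / 2 * (∑ i, (-(u (i - 1) * α' i) + t i * v' i + β i * α' i - t i * β' i) -
        ∑ i, (-(u' (i - 1) * α i) + t' i * v i + β' i * α i - t' i * β i)) := by
    rw [← Finset.sum_sub_distrib, Finset.mul_sum]
    refine Finset.sum_congr rfl fun i _ => ?_
    ring
  rw [h3, h1, h2]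
  unfold xyForm halfForm
  have hcomm : ∀ (f g : ZMod n → ℝ) (c : ZMod n), corr f g (-c) = corr g f c := by
    intro f g c
    rw [corr_comm, neg_neg]
  have h0 : ∀ (f g : ZMod n → ℝ), corr f g 0 = corr g f 0 := by
    intro f g
    rw [corr_comm, neg_zero]
  simp only [hcomm]
  simp only [corr_add_left, corr_add_right, Finset.sum_add_distrib]
  rw [h0 α' α, h0 β' α, h0 α' β, h0 β' β]
  ring

end Correlation

/-! ## The matrix of the bracket in the `(x, y)`-coordinates -/

section PoissMatrix

variable {n : ℕ}

lemma exists_one_le (m : ℕ) (p : ZMod n → Prop) :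
    (∃ l : ℕ, 1 ≤ l ∧ l ≤ m ∧ p l) ↔ ∃ l ∈ Finset.range m, p ((l : ZMod n) + 1) := by
  constructor
  · rintro ⟨l, h1, h2, h3⟩
    obtain ⟨l, rfl⟩ := Nat.exists_eq_add_of_le' h1
    exact ⟨l, Finset.mem_range.2 (by omega), by simpa using h3⟩
  · rintro ⟨l, h1, h2⟩
    exact ⟨l + 1, by omega, Finset.mem_range.1 h1, by simpa using h2⟩

lemma natCast_inj_of_lt {a b : ℕ} (ha : a < n) (hb : b < n) (h : (a : ZMod n) = b) : a = b := by
  rw [ZMod.natCast_eq_natCast_iff'] at h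
  rwa [Nat.mod_eq_of_lt ha, Nat.mod_eq_of_lt hb] at h

lemma natCast_ne_zero_of_lt {a : ℕ} (h0 : 0 < a) (ha : a < n) : (a : ZMod n) ≠ 0 := by
  intro h
  have := natCast_inj_of_lt (b := 0) ha (by omega) (by simpa using h)
  omega

lemma injOn_add_natCast {N : ℕ} (hN : N ≤ n) (i c : ZMod n) :
    Set.InjOn (fun l : ℕ => i + (l + c)) (Finset.range N) := by
  intro a ha b hb h
  simp only [Finset.coe_range, Set.mem_Iio] at ha hb
  exact natCast_inj_of_lt (n := n) (by omega) (by omega) (by simpa using h)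

lemma injOn_sub_natCast {N : ℕ} (hN : N ≤ n) (i c : ZMod n) :
    Set.InjOn (fun l : ℕ => i - (l + c)) (Finset.range N) := by
  intro a ha b hb h
  simp only [Finset.coe_range, Set.mem_Iio] at ha hb
  exact natCast_inj_of_lt (n := n) (by omega) (by omega) (by simpa using h)

/-- Adding the period `m + 1` moves `i - (l + 1)` to `i + (m - l)`, so reflecting the range matches
the two windows. -/
lemma sum_sub_add_of_periodic (m : ℕ) (f : ZMod n → ℝ) (hf : ∀ i, f (i + (m + 1)) = f i)
    (i : ZMod n) :
    ∑ l ∈ Finset.range m, (f (i - (l + 1)) - f (i + (l + 1))) = 0 := by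
  rw [Finset.sum_sub_distrib, sub_eq_zero, ← Finset.sum_range_reflect]
  refine Finset.sum_congr rfl fun l hl => ?_
  rw [Finset.mem_range] at hl
  rw [← hf, Nat.sub_sub, Nat.cast_sub (by omega)]
  push_cast
  congr 1
  ring

variable [NeZero n]

/-- When the windows are injective and disjoint, the nested conditional is a difference of two
indicator functions. This turns rows of `poissMatrix` into sums over index shifts. -/
lemma sum_mul_ite_neg_one_one (s t : Finset ℕ) (f g : ℕ → ZMod n) (hf : Set.InjOn f s)
    (hg : Set.InjOn g t) (hfg : ∀ a ∈ s, ∀ b ∈ t, f a ≠ g b) (P Q : ZMod n → Prop)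
    [DecidablePred P] [DecidablePred Q] (hP : ∀ j, P j ↔ ∃ l ∈ s, j = f l)
    (hQ : ∀ j, Q j ↔ ∃ l ∈ t, j = g l) (u : ZMod n → ℝ) :
    ∑ j, (if P j then (-1 : ℝ) else if Q j then 1 else 0) * u j =
      ∑ l ∈ t, u (g l) - ∑ l ∈ s, u (f l) := by
  have single : ∀ (s : Finset ℕ) (f : ℕ → ZMod n), Set.InjOn f s → ∀ j, (∃ l ∈ s, j = f l) →
      ∑ l ∈ s, (if j = f l then u j else 0) = u j := by
    rintro s f hf j ⟨l, hl, rfl⟩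
    rw [Finset.sum_eq_single_of_mem l hl, if_pos rfl]
    intro b hb hbl
    rw [if_neg fun h => hbl (hf hb hl h.symm)]
  have none : ∀ (s : Finset ℕ) (f : ℕ → ZMod n), ∀ j, (¬ ∃ l ∈ s, j = f l) →
      ∑ l ∈ s, (if j = f l then u j else 0) = 0 := by
    intro s f j h
    exact Finset.sum_eq_zero fun l hl => if_neg fun e => h ⟨l, hl, e⟩
  have swap : ∀ (s : Finset ℕ) (f : ℕ → ZMod n),
      ∑ l ∈ s, u (f l) = ∑ j, ∑ l ∈ s, (if j = f l then u j else 0) := by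
    intro s f
    rw [Finset.sum_comm]
    simp
  rw [swap, swap, ← Finset.sum_sub_distrib]
  refine Finset.sum_congr rfl fun j _ => ?_
  by_cases h : ∃ l ∈ s, j = f l
  · have h' : ¬ ∃ l ∈ t, j = g l := by
      rintro ⟨b, hb, e⟩
      obtain ⟨a, ha, e'⟩ := h
      exact hfg a ha b hb (e'.symm.trans e)
    rw [if_pos ((hP j).2 h), single s f hf j h, none t g j h']
    ring
  · rw [if_neg (mt (hP j).1 h), none s f j h]
    by_cases h' : ∃ l ∈ t, j = g l
    · rw [if_pos ((hQ j).2 h'), single t g hg j h']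
      ring
    · rw [if_neg (mt (hQ j).1 h'), none t g j h']
      ring

lemma sum_mul_ite_one_neg_one (s t : Finset ℕ) (f g : ℕ → ZMod n) (hf : Set.InjOn f s)
    (hg : Set.InjOn g t) (hfg : ∀ a ∈ s, ∀ b ∈ t, f a ≠ g b) (P Q : ZMod n → Prop)
    [DecidablePred P] [DecidablePred Q] (hP : ∀ j, P j ↔ ∃ l ∈ s, j = f l)
    (hQ : ∀ j, Q j ↔ ∃ l ∈ t, j = g l) (u : ZMod n → ℝ) :
    ∑ j, (if P j then (1 : ℝ) else if Q j then -1 else 0) * u j =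
      ∑ l ∈ s, u (f l) - ∑ l ∈ t, u (g l) := by
  rw [← neg_sub, ← sum_mul_ite_neg_one_one s t f g hf hg hfg P Q hP hQ u, ← Finset.sum_neg_distrib]
  refine Finset.sum_congr rfl fun j _ => ?_
  split_ifs <;> ring

/-- The rows of the matrix indexed by `x_i`. -/
lemma poissMatrix_mulVec_inl (m : ℕ) (hn : 2 * m + 3 ≤ n) (u : ZMod n ⊕ ZMod n → ℝ)
    (i : ZMod n) :
    (poissMatrix (m + 2) n).mulVec u (.inl i) =
      ∑ l ∈ Finset.range m, ((u (.inl (i - (l + 1))) + u (.inr (i - (l + 1))))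
        - (u (.inl (i + (l + 1))) + u (.inr (i + (l + 1)))))
      + u (.inr (i - (m + 1))) - u (.inr i) := by
  classical
  have h1 : ∑ j, poissMatrix (m + 2) n (.inl i) (.inl j) * u (.inl j) =
      ∑ l ∈ Finset.range m, u (.inl (i - (l + 1))) - ∑ l ∈ Finset.range m, u (.inl (i + (l + 1))) :=
    sum_mul_ite_neg_one_one (Finset.range m) (Finset.range m) (fun l => i + ((l : ZMod n) + 1))
      (fun l => i - ((l : ZMod n) + 1)) (injOn_add_natCast (by omega) i 1) (injOn_sub_natCast (by omega) i 1)
      (by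
        intro a ha b hb h
        rw [Finset.mem_range] at ha hb
        refine natCast_ne_zero_of_lt (n := n) (a := a + 1 + (b + 1)) (by omega) (by omega) ?_
        push_cast
        linear_combination h)
      _ _ (fun j => exists_one_le m fun l => j = i + l)
      (fun j => (exists_one_le m fun l => i = j + l).trans (by simp only [eq_sub_iff_add_eq, eq_comm]))
      fun j => u (.inl j)
  have h2 : ∑ j, poissMatrix (m + 2) n (.inl i) (.inr j) * u (.inr j) =
      ∑ l ∈ Finset.range (m + 1), u (.inr (i - (l + 1)))
        - ∑ l ∈ Finset.range (m + 1), u (.inr (i + (l + 0))) :=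
    sum_mul_ite_one_neg_one (Finset.range (m + 1)) (Finset.range (m + 1)) (fun l => i - ((l : ZMod n) + 1))
      (fun l => i + ((l : ZMod n) + 0)) (injOn_sub_natCast (by omega) i 1) (injOn_add_natCast (by omega) i 0)
      (by
        intro a ha b hb h
        rw [Finset.mem_range] at ha hb
        refine natCast_ne_zero_of_lt (n := n) (a := a + 1 + b) (by omega) (by omega) ?_
        push_cast
        linear_combination -h)
      _ _ (fun j => (exists_one_le (m + 1) fun l => i = j + l).trans
        (by simp only [eq_sub_iff_add_eq, eq_comm]))
      (fun j => by
        simp only [Nat.add_sub_cancel, Finset.mem_range, Nat.lt_succ_iff, add_zero,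
          eq_sub_iff_add_eq, eq_comm])
      fun j => u (.inr j)
  rw [Matrix.mulVec, dotProduct, Fintype.sum_sum_type, h1, h2, Finset.sum_range_succ,
    Finset.sum_range_succ' (n := m)]
  simp only [Finset.sum_sub_distrib, Finset.sum_add_distrib]
  push_cast
  simp only [add_zero]
  ring

/-- The rows of the matrix indexed by `y_i`. -/
lemma poissMatrix_mulVec_inr (m : ℕ) (hn : 2 * m + 3 ≤ n) (u : ZMod n ⊕ ZMod n → ℝ)
    (i : ZMod n) :
    (poissMatrix (m + 2) n).mulVec u (.inr i) =
      ∑ l ∈ Finset.range m, ((u (.inl (i - (l + 1))) + u (.inr (i - (l + 1))))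
        - (u (.inl (i + (l + 1))) + u (.inr (i + (l + 1)))))
      + u (.inr (i - (m + 1))) + u (.inl i)
      - (u (.inl (i + (m + 1))) + u (.inr (i + (m + 1)))) := by
  classical
  have h1 : ∑ j, poissMatrix (m + 2) n (.inr i) (.inr j) * u (.inr j) =
      ∑ l ∈ Finset.range (m + 1), u (.inr (i - (l + 1)))
        - ∑ l ∈ Finset.range (m + 1), u (.inr (i + (l + 1))) :=
    sum_mul_ite_neg_one_one (Finset.range (m + 1)) (Finset.range (m + 1)) (fun l => i + ((l : ZMod n) + 1))
      (fun l => i - ((l : ZMod n) + 1)) (injOn_add_natCast (by omega) i 1) (injOn_sub_natCast (by omega) i 1)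
      (by
        intro a ha b hb h
        rw [Finset.mem_range] at ha hb
        -- The number can be as large as `2m + 2 = 2k - 2`; here `n ≥ 2k - 1` is needed in full.
        refine natCast_ne_zero_of_lt (n := n) (a := a + 1 + (b + 1)) (by omega) (by omega) ?_
        push_cast
        linear_combination h)
      _ _ (fun j => exists_one_le (m + 1) fun l => j = i + l)
      (fun j => (exists_one_le (m + 1) fun l => i = j + l).trans
        (by simp only [eq_sub_iff_add_eq, eq_comm]))
      fun j => u (.inr j)
  have h2 : ∑ j, poissMatrix (m + 2) n (.inr i) (.inl j) * u (.inl j) =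
      ∑ l ∈ Finset.range (m + 1), u (.inl (i - (l + 0)))
        - ∑ l ∈ Finset.range (m + 1), u (.inl (i + (l + 1))) :=
    sum_mul_ite_neg_one_one (Finset.range (m + 1)) (Finset.range (m + 1)) (fun l => i + ((l : ZMod n) + 1))
      (fun l => i - ((l : ZMod n) + 0)) (injOn_add_natCast (by omega) i 1) (injOn_sub_natCast (by omega) i 0)
      (by
        intro a ha b hb h
        rw [Finset.mem_range] at ha hb
        refine natCast_ne_zero_of_lt (n := n) (a := a + 1 + b) (by omega) (by omega) ?_
        push_cast
        linear_combination h)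
      _ _ (fun j => exists_one_le (m + 1) fun l => j = i + l)
      (fun j => by simp only [Nat.add_sub_cancel, Finset.mem_range, Nat.lt_succ_iff, add_zero])
      fun j => u (.inl j)
  rw [Matrix.mulVec, dotProduct, Fintype.sum_sum_type, h1, h2, Finset.sum_range_succ',
    Finset.sum_range_succ (n := m), Finset.sum_range_succ (n := m),
    Finset.sum_range_succ (n := m)]
  simp only [Finset.sum_sub_distrib, Finset.sum_add_distrib]
  push_cast
  simp only [add_zero, sub_zero]
  ring

/-- The bilinear form of the matrix of the bracket. -/
lemma dotProduct_poissMatrix_mulVec (m : ℕ) (hn : 2 * m + 3 ≤ n) (v u : ZMod n ⊕ ZMod n → ℝ) :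
    dotProduct v ((poissMatrix (m + 2) n).mulVec u) =
      xyForm m (fun i => v (.inl i)) (fun i => v (.inr i)) (fun i => u (.inl i))
        (fun i => u (.inr i)) := by
  set α : ZMod n → ℝ := fun i => v (.inl i)
  set β : ZMod n → ℝ := fun i => v (.inr i)
  set α' : ZMod n → ℝ := fun i => u (.inl i)
  set β' : ZMod n → ℝ := fun i => u (.inr i)
  have hsum : ∑ i, (α i + β i) * ∑ l ∈ Finset.range m,
      ((α' (i - (l + 1)) + β' (i - (l + 1))) - (α' (i + (l + 1)) + β' (i + (l + 1)))) =
      ∑ l ∈ Finset.range m, corr (fun i => α' i + β' i) (fun i => α i + β i) ((l : ZMod n) + 1)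
      - ∑ l ∈ Finset.range m, corr (fun i => α i + β i) (fun i => α' i + β' i)
        ((l : ZMod n) + 1) := by
    simp only [Finset.mul_sum]
    rw [Finset.sum_comm, ← Finset.sum_sub_distrib]
    refine Finset.sum_congr rfl fun l _ => ?_
    rw [corr_comm (fun i => α' i + β' i)]
    simp only [corr, mul_sub, Finset.sum_sub_distrib, ← sub_eq_add_neg]
  have h : dotProduct v ((poissMatrix (m + 2) n).mulVec u) =
      ∑ i, (α i + β i) * ∑ l ∈ Finset.range m,
      ((α' (i - (l + 1)) + β' (i - (l + 1))) - (α' (i + (l + 1)) + β' (i + (l + 1))))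
      + corr (fun i => α i + β i) β' (-((m : ZMod n) + 1))
      - corr (fun i => α i + β i) β' 0 + corr β (fun i => α' i + β' i) 0
      - corr β (fun i => α' i + β' i) ((m : ZMod n) + 1) := by
    rw [dotProduct, Fintype.sum_sum_type]
    simp only [poissMatrix_mulVec_inl m hn, poissMatrix_mulVec_inr m hn, corr,
      ← Finset.sum_sub_distrib, ← Finset.sum_add_distrib]
    refine Finset.sum_congr rfl fun i _ => ?_
    simp only [add_zero, ← sub_eq_add_neg]
    simp only [α, β, α', β', Finset.sum_sub_distrib, Finset.sum_add_distrib]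
    ring
  rw [h, hsum, corr_comm (fun i => α i + β i) β' (-((m : ZMod n) + 1)), neg_neg,
    corr_comm (fun i => α i + β i) β' 0, neg_zero]
  unfold xyForm halfForm
  ring

lemma logCanonicalBracket_poissMatrix (m : ℕ) (hn : 2 * m + 3 ≤ n) (f g : XYSpace n → ℝ)
    (w : XYSpace n) :
    logCanonicalBracket (poissMatrix (m + 2) n) f g w =
      xyForm m (fun i => logPartial f (.inl i) w) (fun i => logPartial f (.inr i) w)
        (fun i => logPartial g (.inl i) w) (fun i => logPartial g (.inr i) w) := by
  rw [← dotProduct_poissMatrix_mulVec m hn (fun a => logPartial f a w) fun a => logPartial g a w]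
  simp only [logCanonicalBracket, dotProduct, Matrix.mulVec, Finset.mul_sum]
  refine Finset.sum_congr rfl fun a _ => Finset.sum_congr rfl fun b _ => ?_
  ring

/-! ### Kernel, rank and Casimir functions -/

/-- Row `y_i` minus row `x_i` is `s_i - s_{i+m+1}`, where `s` adds the two halves of `u`. Hence `s`
is periodic, the window sums in row `x_i` cancel, and what is left of that row says that the
`y`-half is periodic. -/
lemma poissMatrix_mulVec_eq_zero_iff (m : ℕ) (hn : 2 * m + 3 ≤ n) (u : ZMod n ⊕ ZMod n → ℝ) :
    (poissMatrix (m + 2) n).mulVec u = 0 ↔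
      (∀ i, u (.inl (i + (m + 1))) = u (.inl i)) ∧ ∀ i, u (.inr (i + (m + 1))) = u (.inr i) := by
  constructor
  · intro h
    have hx := fun i => congrFun h (.inl i)
    have hy := fun i => congrFun h (.inr i)
    simp only [poissMatrix_mulVec_inl m hn, poissMatrix_mulVec_inr m hn, Pi.zero_apply] at hx hy
    have hs : ∀ i, u (.inl (i + (m + 1))) + u (.inr (i + (m + 1))) = u (.inl i) + u (.inr i) := by
      intro i
      linarith [hx i, hy i]
    have hr : ∀ i, u (.inr (i + (m + 1))) = u (.inr i) := by
      intro i
      have h1 := hx (i + (m + 1))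
      rw [sum_sub_add_of_periodic m (fun j => u (.inl j) + u (.inr j)) hs, add_sub_cancel_right]
        at h1
      linarith
    exact ⟨fun i => by linarith [hs i, hr i], hr⟩
  · rintro ⟨hl, hr⟩
    have hs : ∀ i, u (.inl (i + (m + 1))) + u (.inr (i + (m + 1))) = u (.inl i) + u (.inr i) :=
      fun i => by rw [hl, hr]
    have hr' : ∀ i, u (.inr (i - (m + 1))) = u (.inr i) := fun i => by
      rw [← hr (i - (m + 1)), sub_add_cancel]
    funext a
    rcases a with i | i
    · rw [poissMatrix_mulVec_inl m hn,
        sum_sub_add_of_periodic m (fun j => u (.inl j) + u (.inr j)) hs, hr']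
      simp
    · rw [poissMatrix_mulVec_inr m hn,
        sum_sub_add_of_periodic m (fun j => u (.inl j) + u (.inr j)) hs, hr', hs]
      simp only [Pi.zero_apply]
      ring

/-- The kernel is two copies of the functions on `(ℤ/n) / ⟨m + 1⟩`, a group of order `gcd(m + 1,
n)`; rank-nullity does the rest. -/
lemma poissMatrix_rank (m : ℕ) (hn : 2 * m + 3 ≤ n) :
    (poissMatrix (m + 2) n).rank = 2 * (n - Nat.gcd (m + 1) n) := by
  classical
  set H : AddSubgroup (ZMod n) := AddSubgroup.zmultiples ((m : ZMod n) + 1) with hH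
  set K := LinearMap.ker (poissMatrix (m + 2) n).mulVecLin with hK
  have hmem : ∀ u, u ∈ K ↔ (∀ i, u (.inl (i + (m + 1))) = u (.inl i)) ∧
      ∀ i, u (.inr (i + (m + 1))) = u (.inr i) := fun u => by
    rw [hK, LinearMap.mem_ker, Matrix.mulVecLin_apply, poissMatrix_mulVec_eq_zero_iff m hn]
  let Q := ZMod n ⧸ H
  let L : (Q ⊕ Q → ℝ) →ₗ[ℝ] (ZMod n ⊕ ZMod n → ℝ) :=
    LinearMap.funLeft ℝ ℝ (Sum.map (QuotientAddGroup.mk (s := H)) (QuotientAddGroup.mk (s := H)))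
  have hLinj : Function.Injective L := LinearMap.funLeft_injective_of_surjective _ _ _
    (Sum.map_surjective.2 ⟨QuotientAddGroup.mk_surjective, QuotientAddGroup.mk_surjective⟩)
  have hq : ∀ i : ZMod n, (QuotientAddGroup.mk (i + (m + 1)) : Q) = QuotientAddGroup.mk i := by
    intro i
    exact QuotientAddGroup.mk_add_of_mem i (AddSubgroup.mem_zmultiples _)
  have hlift : ∀ f : ZMod n → ℝ, (∀ i, f (i + (m + 1)) = f i) →
      ∃ g : Q → ℝ, ∀ i, g (QuotientAddGroup.mk i) = f i := by
    intro f hf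
    have hz : ∀ (z : ℤ) (i : ZMod n), f (i + z • ((m : ZMod n) + 1)) = f i := by
      intro z
      induction z using Int.induction_on with
      | zero => simp
      | succ z ih => intro i; rw [add_zsmul, one_zsmul, ← add_assoc, hf, ih]
      | pred z ih =>
        intro i
        rw [sub_zsmul, one_zsmul, ← hf, ← ih i]
        congr 1
        abel
    refine ⟨Quotient.lift f ?_, fun i => rfl⟩
    intro a b hab
    obtain ⟨z, hz'⟩ := AddSubgroup.mem_zmultiples_iff.1 (QuotientAddGroup.leftRel_apply.1 hab)
    rw [← hz z a, hz', add_neg_cancel_left]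
  have hrange : LinearMap.range L = K := by
    ext u
    rw [hmem]
    constructor
    · rintro ⟨g, rfl⟩
      simp only [L, LinearMap.funLeft_apply, Sum.map_inl, Sum.map_inr, hq, implies_true, and_self]
    · rintro ⟨hl, hr⟩
      obtain ⟨g, hg⟩ := hlift (fun i => u (.inl i)) hl
      obtain ⟨g', hg'⟩ := hlift (fun i => u (.inr i)) hr
      refine ⟨Sum.elim g g', ?_⟩
      funext a
      rcases a with i | i
      · simpa [L, LinearMap.funLeft_apply] using hg i
      · simpa [L, LinearMap.funLeft_apply] using hg' i
  have hQ : Nat.card Q = Nat.gcd (m + 1) n := by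
    have h1 := AddSubgroup.card_eq_card_quotient_mul_card_addSubgroup H
    have h2 : addOrderOf ((m : ZMod n) + 1) = n / Nat.gcd n (m + 1) := by
      have := ZMod.addOrderOf_coe (m + 1) (NeZero.ne n)
      push_cast at this
      exact this
    rw [Nat.card_zmultiples, h2, Nat.card_zmod] at h1
    have hd := Nat.gcd_dvd_left n (m + 1)
    have hpos : 0 < n / Nat.gcd n (m + 1) :=
      Nat.div_pos (Nat.le_of_dvd (NeZero.pos n) hd) (Nat.gcd_pos_of_pos_left _ (NeZero.pos n))
    refine Nat.eq_of_mul_eq_mul_right hpos ?_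
    rw [← h1, Nat.gcd_comm (m + 1), Nat.mul_div_cancel' hd]
  have hker : Module.finrank ℝ K = 2 * Nat.gcd (m + 1) n := by
    rw [← hrange, LinearMap.finrank_range_of_inj hLinj, Module.finrank_fintype_fun_eq_card,
      Fintype.card_sum, ← Nat.card_eq_fintype_card, hQ, two_mul]
  have hrk := LinearMap.finrank_range_add_finrank_ker (poissMatrix (m + 2) n).mulVecLin
  rw [← hK, hker, Module.finrank_fintype_fun_eq_card, Fintype.card_sum, ZMod.card] at hrk
  change Module.finrank ℝ (LinearMap.range (poissMatrix (m + 2) n).mulVecLin) = _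
  omega

/-- The matrix of brackets at `w` is `D C D` with `D = diag(w)` invertible. -/
lemma bracketRankAt_eq_rank {ι : Type*} [Fintype ι] [DecidableEq ι] (C : Matrix ι ι ℝ)
    (w : RTorus ι) : bracketRankAt C w = C.rank := by
  have h : (Matrix.of fun a b => logCanonicalBracket C (torusCoord a) (torusCoord b) w) =
      Matrix.diagonal (torusVal w) * C * Matrix.diagonal (torusVal w) := by
    ext a b
    simp only [Matrix.of_apply, logCanonicalBracket, logPartial_coord, Matrix.mul_diagonal,
      Matrix.diagonal_mul, mul_ite, mul_zero, ite_mul, zero_mul, Finset.sum_ite_eq',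
      Finset.mem_univ, if_true, torusVal]
    ring
  have hu : IsUnit (Matrix.diagonal (torusVal w)).det := by
    rw [Matrix.det_diagonal]
    exact (Finset.prod_ne_zero_iff.2 fun a _ => torusVal_ne_zero w a).isUnit
  rw [bracketRankAt, h, Matrix.rank_mul_eq_left_of_isUnit_det _ _ hu,
    Matrix.rank_mul_eq_right_of_isUnit_det _ _ hu]

lemma isCasimir_of_logPartial_periodic (m : ℕ) (hn : 2 * m + 3 ≤ n) {f : XYSpace n → ℝ}
    (hf : TorusSmooth f)
    (hl : ∀ w i, logPartial f (.inl (i + (m + 1))) w = logPartial f (.inl i) w)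
    (hr : ∀ w i, logPartial f (.inr (i + (m + 1))) w = logPartial f (.inr i) w) :
    IsCasimir (poissMatrix (m + 2) n) f := by
  refine ⟨hf, fun g _ w => ?_⟩
  have h := (poissMatrix_mulVec_eq_zero_iff m hn fun a => logPartial f a w).2 ⟨hl w, hr w⟩
  have h' := dotProduct_poissMatrix_mulVec m hn (fun a => logPartial g a w)
    fun a => logPartial f a w
  rw [h, dotProduct_zero] at h'
  rw [logCanonicalBracket_poissMatrix m hn, xyForm_swap, ← h', neg_zero]

omit [NeZero n] in
/-- The multiplicity of a point in the cyclic sequence `s + i (k - 1)` is `(k - 1)`-periodic. -/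
lemma sum_ite_arith_periodic (m : ℕ) (s j : ZMod n) :
    ∑ i ∈ Finset.range (n / Nat.gcd (m + 1) n),
        (if j + (m + 1) = s + (i : ZMod n) * (m + 1) then (1 : ℝ) else 0) =
      ∑ i ∈ Finset.range (n / Nat.gcd (m + 1) n),
        if j = s + (i : ZMod n) * (m + 1) then (1 : ℝ) else 0 := by
  set N := n / Nat.gcd (m + 1) n
  have hN : (N : ZMod n) * (m + 1) = 0 := by
    have : n ∣ N * (m + 1) := by
      obtain ⟨c, hc⟩ := Nat.gcd_dvd_left (m + 1) n
      refine ⟨c, ?_⟩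
      conv_lhs => rw [hc, ← mul_assoc, Nat.div_mul_cancel (Nat.gcd_dvd_right (m + 1) n)]
    have h := (ZMod.natCast_eq_zero_iff (N * (m + 1)) n).2 this
    push_cast at h
    exact h
  -- Shifting `j` by `m + 1` is the same as shifting `i` by one. The progression closes up after `N`
  -- steps, so `F N = F 0` and the two sums agree.
  set F : ℕ → ℝ := fun i => if j + (m + 1) = s + (i : ZMod n) * (m + 1) then 1 else 0 with hF
  have h1 : ∀ i : ℕ, (if j = s + (i : ZMod n) * (m + 1) then (1 : ℝ) else 0) = F (i + 1) := by
    intro i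
    simp only [hF]
    congr 1
    rw [eq_iff_iff]
    rw [Nat.cast_succ, add_mul, one_mul, ← add_assoc s, add_left_inj]
  have h2 : F N = F 0 := by
    simp only [hF, hN, Nat.cast_zero, zero_mul]
  have h3 := Finset.sum_range_sub F N
  rw [h2, sub_self, Finset.sum_sub_distrib, sub_eq_zero] at h3
  simp only [h1]
  exact h3.symm

lemma logPartial_prod_coord {ι α : Type*} [Fintype ι] [DecidableEq ι] (s : Finset α) (c : α → ι)
    (a : ι) (w : RTorus ι) :
    logPartial (fun p => ∏ i ∈ s, (p (c i) : ℝ)) a w =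
      (∏ i ∈ s, (w (c i) : ℝ)) * ∑ i ∈ s, if a = c i then 1 else 0 := by
  have h := dlog_prod (w := w) s (f := fun i => torusCoord (c i))
    (fun i _ => torusSmooth_coord _) (fun i _ => (w (c i)).ne_zero) a
  simp only [dlog_coord] at h
  rw [← h]
  have h0 : ∏ i ∈ s, (w (c i) : ℝ) ≠ 0 := Finset.prod_ne_zero_iff.2 fun i _ => (w (c i)).ne_zero
  simp only [dlog, torusCoord]
  field_simp

lemma isCasimir_prod_inl (m : ℕ) (hn : 2 * m + 3 ≤ n) (s : ZMod n) :
    IsCasimir (poissMatrix (m + 2) n) fun p =>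
      ∏ i ∈ Finset.range (n / Nat.gcd (m + 1) n), (p (.inl (s + i * (m + 1))) : ℝ) := by
  refine isCasimir_of_logPartial_periodic m hn
    (TorusSmooth.prod _ fun i _ => torusSmooth_coord _) (fun w j => ?_) fun w j => ?_
  · simp only [logPartial_prod_coord _ fun i : ℕ => Sum.inl (s + (i : ZMod n) * (m + 1)),
      Sum.inl.injEq, sum_ite_arith_periodic]
  · simp only [logPartial_prod_coord _ fun i : ℕ => Sum.inl (s + (i : ZMod n) * (m + 1)),
      reduceCtorEq]

lemma isCasimir_prod_inr (m : ℕ) (hn : 2 * m + 3 ≤ n) (s : ZMod n) :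
    IsCasimir (poissMatrix (m + 2) n) fun p =>
      ∏ i ∈ Finset.range (n / Nat.gcd (m + 1) n), (p (.inr (s + i * (m + 1))) : ℝ) := by
  refine isCasimir_of_logPartial_periodic m hn
    (TorusSmooth.prod _ fun i _ => torusSmooth_coord _) (fun w j => ?_) fun w j => ?_
  · simp only [logPartial_prod_coord _ fun i : ℕ => Sum.inr (s + (i : ZMod n) * (m + 1)),
      reduceCtorEq]
  · simp only [logPartial_prod_coord _ fun i : ℕ => Sum.inr (s + (i : ZMod n) * (m + 1)),
      Sum.inr.injEq, sum_ite_arith_periodic]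

end PoissMatrix

/-! ## The bracket and the gauge relations at the vertices of a network -/

namespace PerfectNetwork

variable {V E : Type*} (N : PerfectNetwork V E) [Fintype E] [DecidableEq E] [Fintype V]

/-- Each half-edge singles out one edge, so the double sum over edges collapses at every vertex;
half-edge `0` commutes with the others and contributes nothing. -/
lemma logCanonicalBracket_edgeMatrix (f g : RTorus E → ℝ) (w : RTorus E) :
    logCanonicalBracket N.edgeMatrix f g w =
      ∑ v, (if N.white v then (1 / 2 : ℝ) else -(1 / 2)) *
        (logPartial f (N.halfEdge v 1) w * logPartial g (N.halfEdge v 2) w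
          - logPartial f (N.halfEdge v 2) w * logPartial g (N.halfEdge v 1) w) := by
  have h : ∀ v, ∑ e, ∑ e', (∑ i, ∑ j,
      if e = N.halfEdge v i ∧ e' = N.halfEdge v j then vertexMatrix (N.white v) i j else 0)
        * logPartial f e w * logPartial g e' w =
      ∑ i, ∑ j, vertexMatrix (N.white v) i j * logPartial f (N.halfEdge v i) w
        * logPartial g (N.halfEdge v j) w := by
    intro v
    simp only [Finset.sum_mul]
    rw [Finset.sum_congr rfl fun e _ => Finset.sum_comm, Finset.sum_comm]
    refine Finset.sum_congr rfl fun i _ => ?_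
    rw [Finset.sum_congr rfl fun e _ => Finset.sum_comm, Finset.sum_comm]
    refine Finset.sum_congr rfl fun j _ => ?_
    simp [ite_and]
  simp only [logCanonicalBracket, edgeMatrix, Finset.sum_mul]
  rw [Finset.sum_congr rfl fun e _ => Finset.sum_comm, Finset.sum_comm]
  refine Finset.sum_congr rfl fun v _ => ?_
  have hv := h v
  simp only [Finset.sum_mul] at hv
  rw [hv]
  simp [Fin.sum_univ_three, vertexMatrix]
  ring_nf

/-- Gauge invariance in infinitesimal form. -/
lemma logPartial_halfEdge {φ : N.Space → ℝ} (hφ : N.Smooth φ) (w : RTorus E) (v : V) :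
    logPartial (fun u => φ (N.cls u)) (N.halfEdge v 0) w =
      logPartial (fun u => φ (N.cls u)) (N.halfEdge v 1) w
        + logPartial (fun u => φ (N.cls u)) (N.halfEdge v 2) w := by
  classical
  -- Since `φ` is constant along this orbit map, the relation comes from differentiating at `g = 1`
  -- in the direction of `v`: an edge counts `+1` if it leaves `v` and `-1` if it enters `v`.
  let F : RTorus V → RTorus E := fun g => w * N.gauge g
  have hF1 : F 1 = w := by simp [F]
  have hcoe : ∀ e, (fun g => (F g e : ℝ)) = fun g =>
      (w e : ℝ) * (torusCoord (N.src e) g * (torusCoord (N.tgt e) g)⁻¹) := by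
    intro e
    funext g
    simp [F, gauge, torusCoord]
  have hd : ∀ e, TorusDiffAt (torusCoord (N.src e)) (1 : RTorus V) := fun e =>
    (torusSmooth_coord _).diffAt _
  have hd' : ∀ e, TorusDiffAt (fun g => (torusCoord (N.tgt e) g)⁻¹) (1 : RTorus V) := fun e =>
    ((torusSmooth_coord (N.tgt e)).diffAt _).inv (by simp [torusCoord])
  have hc : ∀ e, TorusDiffAt (fun _ => (w e : ℝ)) (1 : RTorus V) := fun e =>
    (torusSmooth_const _).diffAt _
  have hFd : ∀ e, TorusDiffAt (fun g => (F g e : ℝ)) 1 := by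
    intro e
    rw [hcoe]
    exact (hc e).mul ((hd e).mul (hd' e))
  have hlog : ∀ e, logPartial (fun g => (F g e : ℝ)) v 1 / (F 1 e : ℝ) =
      (if v = N.src e then 1 else 0) - if v = N.tgt e then 1 else 0 := by
    intro e
    change dlog (fun g => (F g e : ℝ)) v 1 = _
    rw [hcoe, dlog_mul (hc e) ((hd e).mul (hd' e)) (w e).ne_zero (by simp [torusCoord]),
      dlog_const, dlog_mul (hd e) (hd' e) (by simp [torusCoord]) (by simp [torusCoord]),
      dlog_inv ((torusSmooth_coord (N.tgt e)).diffAt _) (by simp [torusCoord]), dlog_coord,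
      dlog_coord]
    ring
  have hconst : (fun g => φ (N.cls (F g))) = fun _ => φ (N.cls w) := by
    funext g
    have : N.cls (F g) = N.cls w := QuotientGroup.mk_mul_of_mem w ⟨g, rfl⟩
    rw [this]
  have h := logPartial_comp (TorusSmooth.diffAt hφ (F 1)) hFd v
  rw [hconst, logPartial_const] at h
  simp only [hlog, mul_sub, Finset.sum_sub_distrib, mul_ite, mul_one, mul_zero] at h
  rw [hF1] at h
  have pair : ∀ (p : E → Prop) [DecidablePred p] (f : E → ℝ),
      (∀ e, p e ↔ (e = N.halfEdge v 1 ∨ e = N.halfEdge v 2)) →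
      ∑ e, (if p e then f e else 0) = f (N.halfEdge v 1) + f (N.halfEdge v 2) := by
    intro p _ f hp
    rw [← Finset.sum_filter, ← Finset.sum_pair (N.halfEdge_ne v)]
    congr 1
    ext e
    simp [hp]
  have single : ∀ (p : E → Prop) [DecidablePred p] (f : E → ℝ),
      (∀ e, p e ↔ e = N.halfEdge v 0) → ∑ e, (if p e then f e else 0) = f (N.halfEdge v 0) := by
    intro p _ f hp
    simp [hp]
  cases hw : N.white v with
  | true =>
    rw [pair _ _ fun e => eq_comm.trans (N.white_out v hw e),
      single _ _ fun e => eq_comm.trans (N.white_in v hw e)] at h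
    linarith
  | false =>
    rw [single _ _ fun e => eq_comm.trans (N.black_out v hw e),
      pair _ _ fun e => eq_comm.trans (N.black_in v hw e)] at h
    linarith

end PerfectNetwork

/-! ## The bracket of the torus network in the `(x, y)`-coordinates -/

section TorusNetwork

variable {n : ℕ} [NeZero n]

lemma sum_corner (f : Corner → ℝ) :
    ∑ c, f c = f .upperLeft + f .upperRight + f .lowerLeft + f .lowerRight := by
  have : (Finset.univ : Finset Corner) =
    {.upperLeft, .upperRight, .lowerLeft, .lowerRight} := rfl
  rw [this]
  simp [add_assoc]

/-- Valid at every weighting, not only over `𝓕¹`: just the left and lower derivatives survive. This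
is why the bracket restricts to `𝓕¹`. -/
lemma logCanonicalBracket_torusNetwork (m : ℕ) {φ ψ : (torusNetwork (m + 2) n).Space → ℝ}
    (hφ : (torusNetwork (m + 2) n).Smooth φ) (hψ : (torusNetwork (m + 2) n).Smooth ψ)
    (w : RTorus (EdgeKind × ZMod n)) :
    logCanonicalBracket (torusNetwork (m + 2) n).edgeMatrix
      (fun u => φ ((torusNetwork (m + 2) n).cls u)) (fun u => ψ ((torusNetwork (m + 2) n).cls u)) w =
      xyForm m
        (fun i => logPartial (fun u => φ ((torusNetwork (m + 2) n).cls u)) (.left, i) w)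
        (fun i => logPartial (fun u => φ ((torusNetwork (m + 2) n).cls u)) (.lower, i) w)
        (fun i => logPartial (fun u => ψ ((torusNetwork (m + 2) n).cls u)) (.left, i) w)
        (fun i => logPartial (fun u => ψ ((torusNetwork (m + 2) n).cls u)) (.lower, i) w) := by
  have hk : ((m + 2 : ℕ) : ZMod n) - 1 = m + 1 := by push_cast; ring
  have rel : ∀ {φ : (torusNetwork (m + 2) n).Space → ℝ}, (torusNetwork (m + 2) n).Smooth φ → ∀ i : ZMod n,
      logPartial (fun u => φ ((torusNetwork (m + 2) n).cls u)) (.upper, i) w =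
        logPartial (fun u => φ ((torusNetwork (m + 2) n).cls u)) (.blackBlack, i - 1) w
          + logPartial (fun u => φ ((torusNetwork (m + 2) n).cls u)) (.left, i) w ∧
      logPartial (fun u => φ ((torusNetwork (m + 2) n).cls u)) (.upper, i) w =
        logPartial (fun u => φ ((torusNetwork (m + 2) n).cls u)) (.right, i) w
          + logPartial (fun u => φ ((torusNetwork (m + 2) n).cls u)) (.whiteWhite, i) w ∧
      logPartial (fun u => φ ((torusNetwork (m + 2) n).cls u)) (.whiteWhite, i - (m + 1)) w =
        logPartial (fun u => φ ((torusNetwork (m + 2) n).cls u)) (.lower, i) w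
          + logPartial (fun u => φ ((torusNetwork (m + 2) n).cls u)) (.left, i) w ∧
      logPartial (fun u => φ ((torusNetwork (m + 2) n).cls u)) (.blackBlack, i) w =
        logPartial (fun u => φ ((torusNetwork (m + 2) n).cls u)) (.right, i) w
          + logPartial (fun u => φ ((torusNetwork (m + 2) n).cls u)) (.lower, i) w := by
    intro φ hφ i
    have h3 := (torusNetwork (m + 2) n).logPartial_halfEdge hφ w (.lowerLeft, i)
    have h3' : (torusNetwork (m + 2) n).halfEdge (.lowerLeft, i) 0 = (.whiteWhite, i - (m + 1)) := by
      rw [← hk]; rfl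
    rw [h3'] at h3
    exact ⟨(torusNetwork (m + 2) n).logPartial_halfEdge hφ w (.upperLeft, i), (torusNetwork (m + 2) n).logPartial_halfEdge hφ w (.upperRight, i),
      h3, (torusNetwork (m + 2) n).logPartial_halfEdge hφ w (.lowerRight, i)⟩
  have h := xyForm_eq_vertexSum m
    (fun i => logPartial (fun u => φ ((torusNetwork (m + 2) n).cls u)) (.left, i) w)
    (fun i => logPartial (fun u => φ ((torusNetwork (m + 2) n).cls u)) (.lower, i) w)
    (fun i => logPartial (fun u => φ ((torusNetwork (m + 2) n).cls u)) (.blackBlack, i) w)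
    (fun i => logPartial (fun u => φ ((torusNetwork (m + 2) n).cls u)) (.whiteWhite, i) w)
    (fun i => logPartial (fun u => φ ((torusNetwork (m + 2) n).cls u)) (.right, i) w)
    (fun i => logPartial (fun u => ψ ((torusNetwork (m + 2) n).cls u)) (.left, i) w)
    (fun i => logPartial (fun u => ψ ((torusNetwork (m + 2) n).cls u)) (.lower, i) w)
    (fun i => logPartial (fun u => ψ ((torusNetwork (m + 2) n).cls u)) (.blackBlack, i) w)
    (fun i => logPartial (fun u => ψ ((torusNetwork (m + 2) n).cls u)) (.whiteWhite, i) w)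
    (fun i => logPartial (fun u => ψ ((torusNetwork (m + 2) n).cls u)) (.right, i) w)
    (fun i => by rw [(rel hφ i).2.2.1, add_comm]) (fun i => by rw [(rel hψ i).2.2.1, add_comm])
    (fun i => (rel hφ i).2.2.2) (fun i => (rel hψ i).2.2.2)
    (fun i => (rel hφ i).1.symm.trans (rel hφ i).2.1)
    (fun i => (rel hψ i).1.symm.trans (rel hψ i).2.1)
  rw [← h, (torusNetwork (m + 2) n).logCanonicalBracket_edgeMatrix, Fintype.sum_prod_type_right]
  refine Finset.sum_congr rfl fun i _ => ?_
  rw [sum_corner]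
  simp only [torusNetwork, Matrix.cons_val_one, Matrix.cons_val_zero, Matrix.cons_val_two,
    Matrix.tail_cons, Matrix.head_cons, if_true, Bool.false_eq_true, if_false]
  ring

lemma torusSmooth_xyWeights (e : EdgeKind × ZMod n) :
    TorusSmooth fun p : XYSpace n => (xyWeights p e : ℝ) := by
  rcases e with ⟨c, i⟩
  cases c
  · exact torusSmooth_coord _
  · simpa [xyWeights] using torusSmooth_const (1 : ℝ)
  · simpa [xyWeights] using torusSmooth_const (1 : ℝ)
  · exact torusSmooth_coord _
  · simpa [xyWeights] using torusSmooth_const (1 : ℝ)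
  · simpa [xyWeights] using torusSmooth_const (1 : ℝ)

lemma dlog_xyWeights (e : EdgeKind × ZMod n) (a : ZMod n ⊕ ZMod n) (p : XYSpace n) :
    logPartial (fun u : XYSpace n => (xyWeights u e : ℝ)) a p / (xyWeights p e : ℝ) =
      if e = Sum.elim (fun i => (.left, i)) (fun i => (.lower, i)) a then 1 else 0 := by
  change dlog (fun u : XYSpace n => (xyWeights u e : ℝ)) a p = _
  rcases e with ⟨c, i⟩
  have h1 : dlog (fun _ : XYSpace n => (1 : ℝ)) a p = 0 := dlog_const 1 a p
  cases c
  · refine (dlog_coord (Sum.inl i) a p).trans ?_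
    rcases a with j | j <;> simp [eq_comm]
  · rcases a with j | j <;> simpa [xyWeights] using h1
  · rcases a with j | j <;> simpa [xyWeights] using h1
  · refine (dlog_coord (Sum.inr i) a p).trans ?_
    rcases a with j | j <;> simp [eq_comm]
  · rcases a with j | j <;> simpa [xyWeights] using h1
  · rcases a with j | j <;> simpa [xyWeights] using h1

lemma smooth_comp_xyPoint (k : ℕ) {φ : (torusNetwork k n).Space → ℝ}
    (hφ : (torusNetwork k n).Smooth φ) : TorusSmooth fun p => φ (xyPoint k p) :=
  TorusSmooth.comp hφ torusSmooth_xyWeights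

lemma logPartial_xyPoint (k : ℕ) {φ : (torusNetwork k n).Space → ℝ}
    (hφ : (torusNetwork k n).Smooth φ) (a : ZMod n ⊕ ZMod n) (p : XYSpace n) :
    logPartial (fun u => φ (xyPoint k u)) a p =
      logPartial (fun u => φ ((torusNetwork k n).cls u))
        (Sum.elim (fun i => (.left, i)) (fun i => (.lower, i)) a) (xyWeights p) := by
  have h := logPartial_comp (TorusSmooth.diffAt hφ (xyWeights p))
    (fun e => (torusSmooth_xyWeights e).diffAt p) a
  refine h.trans ?_
  simp only [dlog_xyWeights, mul_ite, mul_one, mul_zero, Finset.sum_ite_eq', Finset.mem_univ,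
    if_true]

/-- The restriction of the standard bracket in the `(x, y)`-coordinates. -/
lemma bracket_xyPoint (m : ℕ) {φ ψ : (torusNetwork (m + 2) n).Space → ℝ}
    (hφ : (torusNetwork (m + 2) n).Smooth φ) (hψ : (torusNetwork (m + 2) n).Smooth ψ)
    (p : XYSpace n) :
    (torusNetwork (m + 2) n).bracket φ ψ (xyPoint (m + 2) p) =
      xyForm m (fun i => logPartial (fun u => φ (xyPoint (m + 2) u)) (.inl i) p)
        (fun i => logPartial (fun u => φ (xyPoint (m + 2) u)) (.inr i) p)
        (fun i => logPartial (fun u => ψ (xyPoint (m + 2) u)) (.inl i) p)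
        (fun i => logPartial (fun u => ψ (xyPoint (m + 2) u)) (.inr i) p) := by
  simp only [logPartial_xyPoint _ hφ, logPartial_xyPoint _ hψ]
  exact logCanonicalBracket_torusNetwork m hφ hψ (xyWeights p)

end TorusNetwork

/-! ## Gauge fixing -/

section GaugeFixing

variable {n : ℕ} [NeZero n]

/-- The weight of the path that starts at the upper left corner of the quadrilateral `0` and goes
through the upper, right and black-black edges of `j` consecutive pieces. -/
def pathWeight (w : RTorus (EdgeKind × ZMod n)) (j : ℕ) : ℝˣ :=
  ∏ t ∈ Finset.range j,
    (w (.upper, (t : ZMod n)) * w (.right, (t : ZMod n)) * w (.blackBlack, (t : ZMod n)))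

/-- The weight of the closed cycle through all upper, right and black-black edges. -/
def cycleWeight (w : RTorus (EdgeKind × ZMod n)) : ℝˣ :=
  ∏ i, (w (.upper, i) * w (.right, i) * w (.blackBlack, i))

/-- A gauge transformation that makes all upper, right and monochrome edges of weight `1` if the
cycle weight is `1`. -/
def gaugeFix (k : ℕ) (w : RTorus (EdgeKind × ZMod n)) : Corner × ZMod n → ℝˣ
  | (.upperLeft, i) => pathWeight w i.val
  | (.upperRight, i) => pathWeight w i.val * w (.upper, i)
  | (.lowerRight, i) => pathWeight w i.val * w (.upper, i) * w (.right, i)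
  | (.lowerLeft, i) => pathWeight w (i - (k - 1)).val * w (.upper, i - (k - 1))
      * w (.whiteWhite, i - (k - 1))

/-- The coordinates `(x, y)` as monomials in the edge weights. -/
def xyCoords (k : ℕ) (w : RTorus (EdgeKind × ZMod n)) : XYSpace n
  | .inl i => w (.left, i) * (gaugeFix k w (.lowerLeft, i) * (gaugeFix k w (.upperLeft, i))⁻¹)
  | .inr i => w (.lower, i) * (gaugeFix k w (.lowerLeft, i) * (gaugeFix k w (.lowerRight, i))⁻¹)

lemma prod_range_natCast (f : ZMod n → ℝˣ) :
    ∏ t ∈ Finset.range n, f (t : ZMod n) = ∏ i, f i := by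
  refine Finset.prod_nbij' (fun t : ℕ => (t : ZMod n)) ZMod.val ?_ ?_ ?_ ?_ ?_
  · simp
  · intro i _
    exact Finset.mem_range.2 (ZMod.val_lt i)
  · intro t ht
    exact ZMod.val_cast_of_lt (Finset.mem_range.1 ht)
  · intro i _
    exact ZMod.natCast_zmod_val i
  · simp

/-- Only the step from `n - 1` back to `0` uses `hw`: there the path has gone once around, and its
weight must be that of the empty path. -/
lemma pathWeight_val_add_one {w : RTorus (EdgeKind × ZMod n)} (hw : cycleWeight w = 1)
    (i : ZMod n) : pathWeight w (i + 1).val =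
      pathWeight w i.val * w (.upper, i) * w (.right, i) * w (.blackBlack, i) := by
  have h1 : pathWeight w (i.val + 1) =
      pathWeight w i.val * w (.upper, i) * w (.right, i) * w (.blackBlack, i) := by
    rw [pathWeight, Finset.prod_range_succ, ZMod.natCast_zmod_val]
    simp only [pathWeight, mul_assoc]
  rw [← h1]
  have hv : (i + 1).val = (i.val + 1) % n := by
    rw [← ZMod.val_natCast, Nat.cast_succ, ZMod.natCast_zmod_val]
  rcases Nat.lt_or_ge (i.val + 1) n with h | h
  · rw [hv, Nat.mod_eq_of_lt h]
  · have h' : i.val + 1 = n := le_antisymm (ZMod.val_lt i) h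
    have hn : pathWeight w n = 1 := by
      rw [← hw]
      exact prod_range_natCast fun i => w (.upper, i) * w (.right, i) * w (.blackBlack, i)
    rw [hv, h', Nat.mod_self, hn]
    rfl

/-- `gaugeFix k w v` is the weight of a path from the upper left corner `0` to `v`, so each edge
extending such a path is rescaled by its inverse weight. The cycle condition is needed for the
black-black edges alone. -/
lemma mul_gauge_gaugeFix (k : ℕ) {w : RTorus (EdgeKind × ZMod n)} (hw : cycleWeight w = 1) :
    w * (torusNetwork k n).gauge (gaugeFix k w) = xyWeights (xyCoords k w) := by
  funext e
  rcases e with ⟨c, i⟩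
  cases c
  · rfl
  · change w (.upper, i) * (gaugeFix k w (.upperLeft, i) * (gaugeFix k w (.upperRight, i))⁻¹) = 1
    simp only [gaugeFix]
    apply Units.ext
    push_cast
    field_simp
  · change w (.right, i) * (gaugeFix k w (.upperRight, i) * (gaugeFix k w (.lowerRight, i))⁻¹) = 1
    simp only [gaugeFix]
    apply Units.ext
    push_cast
    field_simp
  · rfl
  · change w (.whiteWhite, i) *
      (gaugeFix k w (.upperRight, i) * (gaugeFix k w (.lowerLeft, i + (k - 1)))⁻¹) = 1
    simp only [gaugeFix, add_sub_cancel_right]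
    apply Units.ext
    push_cast
    field_simp
  · change w (.blackBlack, i) *
      (gaugeFix k w (.lowerRight, i) * (gaugeFix k w (.upperLeft, i + 1))⁻¹) = 1
    simp only [gaugeFix, pathWeight_val_add_one hw]
    apply Units.ext
    push_cast
    field_simp

omit [NeZero n] in
lemma pathWeight_mul_gauge (k : ℕ) (w : RTorus (EdgeKind × ZMod n)) (g : Corner × ZMod n → ℝˣ)
    (j : ℕ) : pathWeight (w * (torusNetwork k n).gauge g) j =
      pathWeight w j * (g (.upperLeft, 0) * (g (.upperLeft, (j : ZMod n)))⁻¹) := by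
  induction j with
  | zero => simp [pathWeight]
  | succ j ih =>
    rw [pathWeight, Finset.prod_range_succ, ← pathWeight, ih, pathWeight, pathWeight,
      Finset.prod_range_succ]
    simp only [Pi.mul_apply, PerfectNetwork.gauge, torusNetwork, MonoidHom.coe_mk, OneHom.coe_mk]
    push_cast
    apply Units.ext
    push_cast
    field_simp

/-- A gauge transformation affects a path weight only through its endpoints. The factor at the
starting corner is common to all `v` and cancels in `xyCoords`, whose invariance thus needs no cycle
condition. -/
lemma gaugeFix_mul_gauge (k : ℕ) (w : RTorus (EdgeKind × ZMod n)) (g : Corner × ZMod n → ℝˣ)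
    (v : Corner × ZMod n) : gaugeFix k (w * (torusNetwork k n).gauge g) v =
      gaugeFix k w v * (g (.upperLeft, 0) * (g v)⁻¹) := by
  rcases v with ⟨c, i⟩
  cases c
  · simp only [gaugeFix, pathWeight_mul_gauge, ZMod.natCast_zmod_val]
  all_goals
    simp only [gaugeFix, pathWeight_mul_gauge, ZMod.natCast_zmod_val]
    simp only [Pi.mul_apply, PerfectNetwork.gauge, torusNetwork, MonoidHom.coe_mk, OneHom.coe_mk,
      sub_add_cancel]
    apply Units.ext
    push_cast
    field_simp

lemma xyCoords_mul_gauge (k : ℕ) (w : RTorus (EdgeKind × ZMod n)) (g : Corner × ZMod n → ℝˣ) :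
    xyCoords k (w * (torusNetwork k n).gauge g) = xyCoords k w := by
  funext a
  rcases a with i | i <;>
  · simp only [xyCoords, gaugeFix_mul_gauge]
    simp only [Pi.mul_apply, PerfectNetwork.gauge, torusNetwork, MonoidHom.coe_mk, OneHom.coe_mk]
    apply Units.ext
    push_cast
    field_simp

omit [NeZero n] in
lemma xyCoords_xyWeights (k : ℕ) (p : XYSpace n) : xyCoords k (xyWeights p) = p := by
  funext a
  rcases a with i | i <;> simp [xyCoords, gaugeFix, pathWeight, xyWeights]

lemma cycleWeight_mul_gauge (k : ℕ) (w : RTorus (EdgeKind × ZMod n))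
    (g : Corner × ZMod n → ℝˣ) :
    cycleWeight (w * (torusNetwork k n).gauge g) = cycleWeight w := by
  have h : ∏ i : ZMod n, g (.upperLeft, i + 1) = ∏ i : ZMod n, g (.upperLeft, i) :=
    Equiv.prod_comp (Equiv.addRight (1 : ZMod n)) fun i => g (.upperLeft, i)
  have h' : cycleWeight (w * (torusNetwork k n).gauge g) =
      cycleWeight w * ((∏ i, g (.upperLeft, i)) * (∏ i, g (.upperLeft, i + 1))⁻¹) := by
    simp only [cycleWeight, ← Finset.prod_inv_distrib, ← Finset.prod_mul_distrib]
    refine Finset.prod_congr rfl fun i _ => ?_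
    simp only [Pi.mul_apply, PerfectNetwork.gauge, torusNetwork, MonoidHom.coe_mk, OneHom.coe_mk]
    apply Units.ext
    push_cast
    field_simp
  rw [h', h, mul_inv_cancel, mul_one]

lemma torusSmooth_units_mul {ι : Type*} [Fintype ι] {F G : RTorus ι → ℝˣ}
    (hF : TorusSmooth fun u => (F u : ℝ)) (hG : TorusSmooth fun u => (G u : ℝ)) :
    TorusSmooth fun u => ((F u * G u : ℝˣ) : ℝ) := by
  simpa using hF.mul hG

lemma torusSmooth_pathWeight (j : ℕ) :
    TorusSmooth fun w : RTorus (EdgeKind × ZMod n) => (pathWeight w j : ℝ) := by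
  simp only [pathWeight, Units.coe_prod]
  refine TorusSmooth.prod _ fun t _ => ?_
  exact torusSmooth_units_mul (torusSmooth_units_mul (torusSmooth_coord _) (torusSmooth_coord _))
    (torusSmooth_coord _)

lemma torusSmooth_gaugeFix (k : ℕ) (v : Corner × ZMod n) :
    TorusSmooth fun w : RTorus (EdgeKind × ZMod n) => (gaugeFix k w v : ℝ) := by
  rcases v with ⟨c, i⟩
  cases c
  · exact torusSmooth_pathWeight _
  · exact torusSmooth_units_mul (torusSmooth_pathWeight _) (torusSmooth_coord _)
  · exact torusSmooth_units_mul
      (torusSmooth_units_mul (torusSmooth_pathWeight _) (torusSmooth_coord _)) (torusSmooth_coord _)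
  · exact torusSmooth_units_mul
      (torusSmooth_units_mul (torusSmooth_pathWeight _) (torusSmooth_coord _)) (torusSmooth_coord _)

lemma torusSmooth_xyCoords (k : ℕ) (a : ZMod n ⊕ ZMod n) :
    TorusSmooth fun w : RTorus (EdgeKind × ZMod n) => (xyCoords k w a : ℝ) := by
  rcases a with i | i <;>
  · exact torusSmooth_units_mul (torusSmooth_coord _)
      (torusSmooth_units_mul (torusSmooth_gaugeFix k _) (torusSmooth_gaugeFix k _).units_inv)

/-! ## The locus `𝓕¹` -/

/-- A gauge invariant function as a function on the quotient. -/
def descend {V E α : Type*} (N : PerfectNetwork V E) (f : RTorus E → α)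
    (hf : ∀ w g, f (w * N.gauge g) = f w) : N.Space → α :=
  fun s => Quotient.liftOn' s f fun w w' h => by
    obtain ⟨g, hg⟩ := QuotientGroup.leftRel_apply.1 h
    rw [show w' = w * N.gauge g by rw [hg, mul_inv_cancel_left], hf]

lemma descend_cls {V E α : Type*} (N : PerfectNetwork V E) (f : RTorus E → α)
    (hf : ∀ w g, f (w * N.gauge g) = f w) (w : RTorus E) : descend N f hf (N.cls w) = f w := rfl

lemma cls_eq_xyPoint (k : ℕ) {w : RTorus (EdgeKind × ZMod n)} (hw : cycleWeight w = 1) :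
    (torusNetwork k n).cls w = xyPoint k (xyCoords k w) := by
  have h : (torusNetwork k n).cls (w * (torusNetwork k n).gauge (gaugeFix k w)) =
      (torusNetwork k n).cls w := QuotientGroup.mk_mul_of_mem w ⟨gaugeFix k w, rfl⟩
  rw [xyPoint, ← mul_gauge_gaugeFix k hw, h]

lemma xyPoint_mem_fOne (k : ℕ) (p : XYSpace n) : xyPoint k p ∈ fOne k n :=
  ⟨xyWeights p, rfl, fun _ => rfl, fun _ => rfl, by simp [xyWeights]⟩

/-- For the representatives in `fOne` the black-black weights are `1`, so the invariant
`cycleWeight` reduces to `∏ b_i c_i`; conversely, gauge fixing produces such a representative. -/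
lemma cls_mem_fOne_iff (k : ℕ) (w : RTorus (EdgeKind × ZMod n)) :
    (torusNetwork k n).cls w ∈ fOne k n ↔ cycleWeight w = 1 := by
  constructor
  · rintro ⟨w', hw, -, hb, hc⟩
    have h := congrArg (descend (torusNetwork k n) cycleWeight (cycleWeight_mul_gauge k)) hw
    rw [descend_cls, descend_cls] at h
    rw [← h, ← hc]
    simp [cycleWeight, hb]
  · intro h
    rw [cls_eq_xyPoint k h]
    exact xyPoint_mem_fOne k _

lemma range_xyPoint (k : ℕ) : Set.range (xyPoint k (n := n)) = fOne k n := by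
  ext s
  constructor
  · rintro ⟨p, rfl⟩
    exact xyPoint_mem_fOne k p
  · intro h
    obtain ⟨w, rfl⟩ := QuotientGroup.mk_surjective s
    exact ⟨xyCoords k w, (cls_eq_xyPoint k ((cls_mem_fOne_iff k w).1 h)).symm⟩

lemma descend_xyCoords_xyPoint (k : ℕ) (p : XYSpace n) :
    descend (torusNetwork k n) (xyCoords k) (xyCoords_mul_gauge k) (xyPoint k p) = p :=
  xyCoords_xyWeights k p

lemma xyPoint_injective (k : ℕ) : Function.Injective (xyPoint k (n := n)) :=
  Function.LeftInverse.injective (descend_xyCoords_xyPoint k)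

/-- A function of `(x, y)` is extended to all of `𝓕` by composing it with the retraction that
`xyCoords` induces. -/
lemma torusSmooth_iff_exists_comp_xyPoint (k : ℕ) (h : XYSpace n → ℝ) :
    TorusSmooth h ↔ ∃ φ, (torusNetwork k n).Smooth φ ∧ h = fun p => φ (xyPoint k p) := by
  constructor
  · intro hh
    refine ⟨fun s => h (descend (torusNetwork k n) (xyCoords k) (xyCoords_mul_gauge k) s),
      hh.comp (torusSmooth_xyCoords k), ?_⟩
    simp only [descend_xyCoords_xyPoint]
  · rintro ⟨φ, hφ, rfl⟩
    exact smooth_comp_xyPoint k hφ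

lemma cycleWeight_eq_prod (w : RTorus (EdgeKind × ZMod n)) :
    (cycleWeight w : ℝ) = ∏ q : Fin 3 × ZMod n,
      (w (![EdgeKind.upper, .right, .blackBlack] q.1, q.2) : ℝ) := by
  rw [Fintype.prod_prod_type_right, cycleWeight, Units.coe_prod]
  refine Finset.prod_congr rfl fun i _ => ?_
  simp [Fin.prod_univ_three]

lemma logPartial_cycleWeight_ne_zero (w : RTorus (EdgeKind × ZMod n)) :
    logPartial (fun u => (cycleWeight u : ℝ)) (.upper, 0) w ≠ 0 := by
  simp only [cycleWeight_eq_prod]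
  rw [logPartial_prod_coord _
    fun q : Fin 3 × ZMod n => (![EdgeKind.upper, .right, .blackBlack] q.1, q.2)]
  refine mul_ne_zero (Finset.prod_ne_zero_iff.2 fun q _ => (w _).ne_zero) (ne_of_gt ?_)
  refine Finset.sum_pos' (fun q _ => ?_) ⟨(0, 0), Finset.mem_univ _, ?_⟩
  · split_ifs <;> norm_num
  · simp

/-- The single equation `cycleWeight = 1` works globally, so the neighbourhood is the whole space;
its differential is nonzero already along one upper edge. -/
lemma isEmbeddedSubmanifold_fOne (k : ℕ) :
    (torusNetwork k n).IsEmbeddedSubmanifold (fOne k n) 1 := by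
  intro s _
  have hsm : TorusSmooth fun w : RTorus (EdgeKind × ZMod n) => (cycleWeight w : ℝ) := by
    simp only [cycleWeight_eq_prod]
    exact TorusSmooth.prod _ fun q _ => torusSmooth_coord _
  refine ⟨Set.univ, isOpen_univ, Set.mem_univ s, fun _ t =>
    ((descend (torusNetwork k n) cycleWeight (cycleWeight_mul_gauge k) t : ℝˣ) : ℝ) - 1,
    fun _ => hsm.sub (torusSmooth_const 1), ?_, fun w _ => ?_⟩
  · simp only [Set.inter_univ]
    ext t
    obtain ⟨w, rfl⟩ := QuotientGroup.mk_surjective t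
    refine (cls_mem_fOne_iff k w).trans ?_
    change _ ↔ ∀ _ : Fin 1, (cycleWeight w : ℝ) - 1 = 0
    simp [sub_eq_zero]
  · rw [linearIndependent_unique_iff]
    intro h
    refine logPartial_cycleWeight_ne_zero w ?_
    rw [← logPartial_sub_const (hsm.diffAt w) 1]
    exact congrFun h (.upper, 0)

lemma isPoissonSubmanifold_fOne (m : ℕ) :
    (torusNetwork (m + 2) n).IsPoissonSubmanifold (fOne (m + 2) n) 1 := by
  refine ⟨isEmbeddedSubmanifold_fOne _, fun φ ψ hφ hψ h s hs => ?_⟩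
  rw [← range_xyPoint] at hs
  obtain ⟨p, rfl⟩ := hs
  have h0 : (fun u => ψ (xyPoint (m + 2) u)) = fun _ => 0 := by
    funext u
    exact h _ (xyPoint_mem_fOne _ u)
  rw [bracket_xyPoint m hφ hψ, h0]
  simp [xyForm, halfForm, corr]

end GaugeFixing

/-! ## Invariance under `T_k` -/

section MapT

variable {n : ℕ} [NeZero n]

/-- The sum `σ_i = x_i + y_i`. -/
def xySum (i : ZMod n) (p : XYSpace n) : ℝ :=
  torusCoord (.inl i) p + torusCoord (.inr i) p

lemma torusDiffAt_xySum (i : ZMod n) (p : XYSpace n) : TorusDiffAt (xySum i) p :=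
  ((torusSmooth_coord _).diffAt p).add ((torusSmooth_coord _).diffAt p)

lemma dlog_xySum (i : ZMod n) (a : ZMod n ⊕ ZMod n) (p : XYSpace n) :
    dlog (xySum i) a p = (if a = .inl i then (p (.inl i) : ℝ) / xySum i p else 0)
      + if a = .inr i then (p (.inr i) : ℝ) / xySum i p else 0 := by
  have h := logPartial_add ((torusSmooth_coord (.inl i)).diffAt p)
    ((torusSmooth_coord (.inr i)).diffAt p) a
  rw [logPartial_coord, logPartial_coord] at h
  unfold dlog
  change logPartial (fun u => torusCoord (.inl i) u + torusCoord (.inr i) u) a p / _ = _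
  rw [h, add_div]
  split_ifs <;> simp

lemma mapDomain_mem_nhds {p : XYSpace n} (hp : p ∈ mapDomain n) :
    {v : ZMod n ⊕ ZMod n → ℝ | ∀ i, v (.inl i) + v (.inr i) ≠ 0} ∈ nhds (torusVal p) := by
  refine IsOpen.mem_nhds ?_ hp
  simp only [Set.ofPred_forall]
  exact isOpen_iInter_of_finite fun i => isOpen_ne_fun
    ((continuous_apply (Sum.inl i)).add (continuous_apply (Sum.inr i))) continuous_const

lemma toUnit_val {a : ℝ} (ha : a ≠ 0) : (toUnit a : ℝ) = a := by
  simp [toUnit, ha]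

/-- The common form `z σ_i σ_j⁻¹` of the components of `T_k`. -/
def mapMonomial (b : ZMod n ⊕ ZMod n) (i j : ZMod n) (p : XYSpace n) : ℝ :=
  torusCoord b p * (xySum i p * (xySum j p)⁻¹)

omit [NeZero n] in
lemma toUnit_mapMonomial (b : ZMod n ⊕ ZMod n) (i j : ZMod n) {p : XYSpace n}
    (hp : p ∈ mapDomain n) : (toUnit (mapMonomial b i j p) : ℝ) = mapMonomial b i j p :=
  toUnit_val (mul_ne_zero (p b).ne_zero (mul_ne_zero (hp i) (inv_ne_zero (hp j))))

lemma torusDiffAt_mapMonomial (b : ZMod n ⊕ ZMod n) (i j : ZMod n) {p : XYSpace n}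
    (hp : p ∈ mapDomain n) : TorusDiffAt (fun u => (toUnit (mapMonomial b i j u) : ℝ)) p := by
  have h : TorusDiffAt (mapMonomial b i j) p := ((torusSmooth_coord b).diffAt p).mul
    ((torusDiffAt_xySum i p).mul ((torusDiffAt_xySum j p).inv (hp j)))
  exact h.congr (mapDomain_mem_nhds hp) fun u hu => toUnit_mapMonomial b i j hu

lemma dlog_mapMonomial (b : ZMod n ⊕ ZMod n) (i j : ZMod n) {p : XYSpace n}
    (hp : p ∈ mapDomain n) (a : ZMod n ⊕ ZMod n) :
    dlog (fun u => (toUnit (mapMonomial b i j u) : ℝ)) a p =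
      (if a = b then 1 else 0) + (dlog (xySum i) a p - dlog (xySum j) a p) := by
  rw [dlog_congr (g := mapMonomial b i j) (mapDomain_mem_nhds hp)
    fun u hu => toUnit_mapMonomial b i j hu]
  have hinv := (torusDiffAt_xySum j p).inv (hp j)
  have h0 : (xySum j p)⁻¹ ≠ 0 := inv_ne_zero (hp j)
  unfold mapMonomial
  rw [dlog_mul ((torusSmooth_coord b).diffAt p) ((torusDiffAt_xySum i p).mul hinv) (p b).ne_zero
    (mul_ne_zero (hp i) h0), dlog_coord,
    dlog_mul (torusDiffAt_xySum i p) hinv (hp i) h0,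
    dlog_inv (torusDiffAt_xySum j p) (hp j)]
  ring

omit [NeZero n] in
lemma mapT_inl (k : ℕ) (p : XYSpace n) (i : ZMod n) :
    mapT k p (.inl i) = toUnit (mapMonomial (.inl (i - ((k - 2 - (k / 2 - 1) : ℕ) : ZMod n) - 1))
      (i + ((k / 2 - 1 : ℕ) : ZMod n)) (i - ((k - 2 - (k / 2 - 1) : ℕ) : ZMod n) - 1) p) := rfl

omit [NeZero n] in
lemma mapT_inr (k : ℕ) (p : XYSpace n) (i : ZMod n) :
    mapT k p (.inr i) = toUnit (mapMonomial (.inr (i - ((k - 2 - (k / 2 - 1) : ℕ) : ZMod n)))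
      (i + ((k / 2 - 1 : ℕ) : ZMod n) + 1) (i - ((k - 2 - (k / 2 - 1) : ℕ) : ZMod n)) p) := rfl

/-- The logarithmic derivatives of a pull-back under `T_k`. -/
lemma logPartial_comp_mapT (k : ℕ) {f : XYSpace n → ℝ} (hf : TorusSmooth f) {p : XYSpace n}
    (hp : p ∈ mapDomain n) (r r' : ℕ) (hr : r = k / 2 - 1) (hr' : r' = k - 2 - r)
    (α β : ZMod n → ℝ) (hα : ∀ i, α i = logPartial f (.inl i) (mapT k p))
    (hβ : ∀ i, β i = logPartial f (.inr i) (mapT k p)) (j : ZMod n) :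
    logPartial (fun u => f (mapT k u)) (.inl j) p = α (j + r' + 1) + p (.inl j) / xySum j p *
      ((α (j - r) + β (j - r - 1)) - (α (j + r' + 1) + β (j + r'))) ∧
    logPartial (fun u => f (mapT k u)) (.inr j) p = β (j + r') + p (.inr j) / xySum j p *
      ((α (j - r) + β (j - r - 1)) - (α (j + r' + 1) + β (j + r'))) := by
  have hd : ∀ a, TorusDiffAt (fun u => (mapT k u a : ℝ)) p := by
    rintro (i | i)
    · simp only [mapT_inl]
      exact torusDiffAt_mapMonomial _ _ _ hp
    · simp only [mapT_inr]
      exact torusDiffAt_mapMonomial _ _ _ hp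
  have hl : ∀ i a, logPartial (fun u => (mapT k u (.inl i) : ℝ)) a p / (mapT k p (.inl i) : ℝ) =
      (if a = .inl (i - r' - 1) then 1 else 0)
        + (dlog (xySum (i + (r : ZMod n))) a p - dlog (xySum (i - (r' : ZMod n) - 1)) a p) := by
    intro i a
    subst hr hr'
    exact dlog_mapMonomial _ _ _ hp a
  have hl' : ∀ i a, logPartial (fun u => (mapT k u (.inr i) : ℝ)) a p / (mapT k p (.inr i) : ℝ) =
      (if a = .inr (i - r') then 1 else 0)
        + (dlog (xySum (i + (r : ZMod n) + 1)) a p - dlog (xySum (i - (r' : ZMod n))) a p) := by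
    intro i a
    subst hr hr'
    exact dlog_mapMonomial _ _ _ hp a
  -- Solving for `i` lists the components of `T_k` that involve the coordinates with index `j`, so
  -- that the sums over `i` collapse.
  have e1 : ∀ i, j = i - (r' : ZMod n) - 1 ↔ i = j + r' + 1 := fun i =>
    ⟨fun h => by rw [h]; ring, fun h => by rw [h]; ring⟩
  have e2 : ∀ i, j = i + (r : ZMod n) ↔ i = j - r := fun i =>
    ⟨fun h => by rw [h]; ring, fun h => by rw [h]; ring⟩
  have e3 : ∀ i, j = i - (r' : ZMod n) ↔ i = j + r' := fun i =>
    ⟨fun h => by rw [h]; ring, fun h => by rw [h]; ring⟩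
  have e4 : ∀ i, j = i + (r : ZMod n) + 1 ↔ i = j - r - 1 := fun i =>
    ⟨fun h => by rw [h]; ring, fun h => by rw [h]; ring⟩
  have hc : ∀ (z : ZMod n → ℝ) i t, (if j = t then z i * (p (.inl t) / xySum t p) else 0) =
      if j = t then z i * (p (.inl j) / xySum j p) else 0 := by
    intro z i t
    split_ifs with h
    · rw [h]
    · rfl
  have hc' : ∀ (z : ZMod n → ℝ) i t, (if j = t then z i * (p (.inr t) / xySum t p) else 0) =
      if j = t then z i * (p (.inr j) / xySum j p) else 0 := by
    intro z i t
    split_ifs with h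
    · rw [h]
    · rfl
  constructor
  · rw [logPartial_comp (hf.diffAt _) hd, Fintype.sum_sum_type]
    simp only [hl, hl', ← hα, ← hβ, dlog_xySum, Sum.inl.injEq, reduceCtorEq, if_false, add_zero,
      zero_add, mul_add, mul_sub, Finset.sum_add_distrib, Finset.sum_sub_distrib, mul_ite, mul_one,
      mul_zero, hc]
    simp only [e1, e2, e3, e4, Finset.sum_ite_eq', Finset.mem_univ, if_true]
    ring
  · rw [logPartial_comp (hf.diffAt _) hd, Fintype.sum_sum_type]
    simp only [hl, hl', ← hα, ← hβ, dlog_xySum, Sum.inr.injEq, reduceCtorEq, if_false,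
      zero_add, mul_add, mul_sub, Finset.sum_add_distrib, Finset.sum_sub_distrib, mul_ite, mul_one,
      mul_zero, hc']
    simp only [e1, e2, e3, e4, Finset.sum_ite_eq', Finset.mem_univ, if_true]
    ring

lemma bracketInvariantOn_mapT (m : ℕ) (hn : 2 * m + 3 ≤ n) :
    BracketInvariantOn (poissMatrix (m + 2) n) (mapT (m + 2)) (mapDomain n) := by
  intro f g hf hg p hp
  have hf' := logPartial_comp_mapT (m + 2) hf hp _ _ rfl rfl _ _ (fun _ => rfl) fun _ => rfl
  have hg' := logPartial_comp_mapT (m + 2) hg hp _ _ rfl rfl _ _ (fun _ => rfl) fun _ => rfl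
  -- This is the only property of the two weights that is needed. Likewise `r` and `r'` enter only
  -- through `r + r' = m`, so any splitting of `m` would do.
  have hsum : ∀ j, (p (.inl j) : ℝ) / xySum j p + p (.inr j) / xySum j p = 1 := by
    intro j
    rw [← add_div]
    exact div_self (hp j)
  rw [logCanonicalBracket_poissMatrix m hn, logCanonicalBracket_poissMatrix m hn]
  refine xyForm_pullback m ((m + 2) / 2 - 1) (m + 2 - 2 - ((m + 2) / 2 - 1)) (by omega)
    (fun j => p (.inr j) / xySum j p) _ _ _ _ _ _ _ _ (fun j => (hf' j).2) (fun j => (hg' j).2)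
    (fun j => ?_) fun j => ?_
  · rw [(hf' j).1, (hf' j).2]
    linear_combination ((logPartial f (.inl (j - (((m + 2) / 2 - 1 : ℕ) : ZMod n))) (mapT (m + 2) p)
      + logPartial f (.inr (j - (((m + 2) / 2 - 1 : ℕ) : ZMod n) - 1)) (mapT (m + 2) p))
      - (logPartial f (.inl (j + ((m + 2 - 2 - ((m + 2) / 2 - 1) : ℕ) : ZMod n) + 1)) (mapT (m + 2) p)
      + logPartial f (.inr (j + ((m + 2 - 2 - ((m + 2) / 2 - 1) : ℕ) : ZMod n))) (mapT (m + 2) p))) * hsum j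
  · rw [(hg' j).1, (hg' j).2]
    linear_combination ((logPartial g (.inl (j - (((m + 2) / 2 - 1 : ℕ) : ZMod n))) (mapT (m + 2) p)
      + logPartial g (.inr (j - (((m + 2) / 2 - 1 : ℕ) : ZMod n) - 1)) (mapT (m + 2) p))
      - (logPartial g (.inl (j + ((m + 2 - 2 - ((m + 2) / 2 - 1) : ℕ) : ZMod n) + 1)) (mapT (m + 2) p)
      + logPartial g (.inr (j + ((m + 2 - 2 - ((m + 2) / 2 - 1) : ℕ) : ZMod n))) (mapT (m + 2) p))) * hsum j

end MapT

end

theorem mainTheorem4 (n k : ℕ) [NeZero n] (hk : 2 ≤ k) (hkn : k ≤ n) :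
    -- (i) `𝓕¹` is a Poisson submanifold; it is parametrized by `(x, y)`
    (torusNetwork k n).IsPoissonSubmanifold (fOne k n) 1 ∧
    Function.Injective (xyPoint k (n := n)) ∧ Set.range (xyPoint k (n := n)) = fOne k n ∧
    (∀ h : XYSpace n → ℝ, TorusSmooth h ↔
      ∃ φ, (torusNetwork k n).Smooth φ ∧ h = fun p => φ (xyPoint k p)) ∧
    (2 * k - 1 ≤ n →
      -- (i) the restriction of the standard bracket to `𝓕¹` in the coordinates `x, y`
      (∀ φ ψ, (torusNetwork k n).Smooth φ → (torusNetwork k n).Smooth ψ → ∀ p : XYSpace n,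
        (torusNetwork k n).bracket φ ψ (xyPoint k p) =
          logCanonicalBracket (poissMatrix k n)
            (fun u => φ (xyPoint k u)) (fun u => ψ (xyPoint k u)) p) ∧
      -- (ii) the rank and the Casimir functions
      (∀ p : XYSpace n,
        bracketRankAt (poissMatrix k n) p = 2 * (n - Nat.gcd (k - 1) n)) ∧
      (∀ s ∈ Finset.Icc 1 (Nat.gcd (k - 1) n),
        IsCasimir (poissMatrix k n) (fun p => ∏ i ∈ Finset.range (n / Nat.gcd (k - 1) n),
          (p (Sum.inl ((s : ZMod n) + i * (k - 1))) : ℝ)) ∧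
        IsCasimir (poissMatrix k n) (fun p => ∏ i ∈ Finset.range (n / Nat.gcd (k - 1) n),
          (p (Sum.inr ((s : ZMod n) + i * (k - 1))) : ℝ))) ∧
      -- (iii) invariance under `T_k`
      BracketInvariantOn (poissMatrix k n) (mapT k) (mapDomain n)) := by
  -- With `k = m + 2` the truncated differences `k - 1` and `k - 2` become `m + 1` and `m`, and `2 *
  -- k - 1 ≤ n` becomes `2 * m + 3 ≤ n`.
  obtain ⟨m, rfl⟩ := Nat.exists_eq_add_of_le' hk
  refine ⟨isPoissonSubmanifold_fOne m, xyPoint_injective _, range_xyPoint _,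
    torusSmooth_iff_exists_comp_xyPoint _, fun h => ?_⟩
  have hn : 2 * m + 3 ≤ n := by omega
  have hk1 : ((m + 2 : ℕ) : ZMod n) - 1 = m + 1 := by push_cast; ring
  refine ⟨fun φ ψ hφ hψ p => ?_, fun p => ?_, fun s _ => ?_, bracketInvariantOn_mapT m hn⟩
  · rw [bracket_xyPoint m hφ hψ, logCanonicalBracket_poissMatrix m hn]
  · rw [bracketRankAt_eq_rank]
    exact poissMatrix_rank m hn
  · rw [hk1]
    exact ⟨isCasimir_prod_inl m hn s, isCasimir_prod_inr m hn s⟩
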